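/- Let $q\in(0,1)$ and let $H$ be a complex Hilbert space. Let $\mathcal F_q(H)$ be the $q$-Fock space over $H$, i.e. the completion of the algebraic full Fock space $\mathbb C\Omega\oplus\bigoplus_{n\ge1}H^{\otimes n}$ with respect to the inner product determined by $\langle\Omega,\Omega\rangle_q=1$ and $$\langle g_1\otimes\cdots\otimes g_m,\,h_1\otimes\cdots\otimes h_n\rangle_q=\delta_{mn}\sum_{k=1}^n q^{k-1}\langle g_1,h_k\rangle\,\langle g_2\otimes\cdots\otimes g_m,\,h_1\otimes\cdots\check h_k\cdots\otimes h_n\rangle_q .$$ For $f\in H$ let $a(f)^*$ be the bounded operator $\xi\mapsto f\otimes\xi$ on $\mathcal F_q(H)$ and $a(f)$ its adjoint, so that $a(f)\Omega=0$ and $a(f)\,h_1\otimes\cdots\otimes h_n=\sum_{k=1}^n q^{k-1}\langle f,h_k\rangle\,h_1\otimes\cdots\check h_k\cdots\otimes h_n$. The distribution of a bounded self-adjoint operator $T$ on $\mathcal F_q(H)$ is the Borel probability measure $\mu_T$ on $\mathbb R$ with $\int\varphi\,d\mu_T=\langle\Omega,\varphi(T)\Omega\rangle_q$ for all compactly supported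 continuous $\varphi$. Let $f_0,f_1\in H$ be orthogonal unit vectors and put $X_0=a(f_0)+a(f_0)^*$ and $X_1=a(f_1)+a(f_1)^*$. Then there is a continuous function $\gamma\colon\mathbb R\to\mathbb R$ such that $\gamma(X_0)$ and $X_0$ have the same distribution, but $\gamma(X_0)+X_1$ and $X_0+X_1$ have different distributions; more precisely, $$\langle\Omega,(\gamma(X_0)+X_1)^4\,\Omega\rangle_q<8+4q=\langle\Omega,(X_0+X_1)^4\,\Omega\rangle_q .$$ Consequently no $q$-convolution exists for these variables: there is no binary operation $*$ on Borel measures on $\mathbb R$ such that $\mu_{\varphi(X_0)+\psi(X_1)}=\mu_{\varphi(X_0)}*\mu_{\psi(X_1)}$ for all continuous $\varphi,\psi\colon\mathbb R\to\mathbb R$. -/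

import Mathlib

noncomputable section

open TensorAlgebra

/-! ## The algebraic full Fock space `ℂ ⊕ H ⊕ H⊗H ⊕ ⋯`, realised as the tensor algebra of `H` -/

section Algebraic

variable {H : Type*} [NormedAddCommGroup H] [InnerProductSpace ℂ H]

/-- Auxiliary map for the annihilation operator: `g` acts on pairs by
`(ξ, η) ↦ (g ⊗ ξ, ⟨f, g⟩ ξ + q g ⊗ η)`. -/
def annihStep (q : ℝ) (f : H) :
    H →ₗ[ℂ] Module.End ℂ (TensorAlgebra ℂ H × TensorAlgebra ℂ H) where
  toFun g := LinearMap.prod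
    (LinearMap.mulLeft ℂ (ι ℂ g) ∘ₗ LinearMap.fst ℂ _ _)
    (inner ℂ f g • LinearMap.fst ℂ _ _
      + (q : ℂ) • (LinearMap.mulLeft ℂ (ι ℂ g) ∘ₗ LinearMap.snd ℂ _ _))
  map_add' g g' := by
    ext <;> simp [add_mul, add_smul]
  map_smul' c g := by
    ext <;> simp [mul_smul, smul_comm (q : ℂ) c]

/-- The annihilation operator `a(f)` on the algebraic Fock space: the linear map with `a(f) Ω = 0`
and `a(f) (g ⊗ ξ) = ⟨f, g⟩ ξ + q g ⊗ a(f) ξ`; see `annihAlg_tprod` for the explicit formula. -/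
def annihAlg (q : ℝ) (f : H) : TensorAlgebra ℂ H →ₗ[ℂ] TensorAlgebra ℂ H where
  toFun ξ := (lift ℂ (annihStep q f) ξ (1, 0)).2
  map_add' := by simp
  map_smul' := by simp

/-- The creation operator `a(f)^*` on the algebraic Fock space: `ξ ↦ f ⊗ ξ`. -/
def creatAlg (f : H) : TensorAlgebra ℂ H →ₗ[ℂ] TensorAlgebra ℂ H :=
  LinearMap.mulLeft ℂ (ι ℂ f)

theorem creatAlg_apply (f : H) (ξ : TensorAlgebra ℂ H) : creatAlg f ξ = ι ℂ f * ξ := rfl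

theorem tensor_induction {P : TensorAlgebra ℂ H → Prop} (one : P 1)
    (add : ∀ ξ η, P ξ → P η → P (ξ + η)) (smul : ∀ (c : ℂ) ξ, P ξ → P (c • ξ))
    (tensor : ∀ g ξ, P ξ → P (ι ℂ g * ξ)) (ξ : TensorAlgebra ℂ H) : P ξ := by
  have key : ∀ ξ : TensorAlgebra ℂ H, ∀ η, P η → P (ξ * η) := by
    intro ξ
    induction ξ using TensorAlgebra.induction with
    | algebraMap r => intro η hη; rw [← Algebra.smul_def]; exact smul r η hη
    | ι x => exact fun η hη => tensor x η hη
    | mul a b ha hb => intro η hη; rw [mul_assoc]; exact ha _ (hb _ hη)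
    | add a b ha hb => intro η hη; rw [add_mul]; exact add _ _ (ha _ hη) (hb _ hη)
  simpa using key ξ 1 one

@[simp] theorem annihAlg_one (q : ℝ) (f : H) : annihAlg q f 1 = 0 := by
  simp [annihAlg]

/-- The `q`-commutation relation `a(f) a(g)^* = q a(g)^* a(f) + ⟨f, g⟩`. -/
theorem annihAlg_ι_mul (q : ℝ) (f g : H) (ξ : TensorAlgebra ℂ H) :
    annihAlg q f (ι ℂ g * ξ) = inner ℂ f g • ξ + (q : ℂ) • (ι ℂ g * annihAlg q f ξ) := by
  have h1 : ∀ ξ η : TensorAlgebra ℂ H, ∀ ζ, (lift ℂ (annihStep q f) ξ (η, ζ)).1 = ξ * η := by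
    intro ξ
    induction ξ using TensorAlgebra.induction with
    | algebraMap r => intro η ζ; simp [Algebra.smul_def]
    | ι x => intro η ζ; simp [annihStep]
    | mul a b ha hb =>
      intro η ζ
      rw [map_mul, Module.End.mul_apply,
        ← Prod.mk.eta (p := (lift ℂ (annihStep q f)) b (η, ζ)), ha, hb, mul_assoc]
    | add a b ha hb => intro η ζ; simp [ha, hb, add_mul]
  have h2 := h1 ξ 1 0
  simp only [annihAlg, LinearMap.coe_mk, AddHom.coe_mk, map_mul, Module.End.mul_apply,
    lift_ι_apply]
  simp only [annihStep, LinearMap.coe_mk, AddHom.coe_mk] at h2 ⊢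
  simp [h2]

/-- The explicit formula for the annihilation operator on elementary tensors:
`a(f) h_0 ⊗ ⋯ ⊗ h_n = ∑ k, q ^ k ⟨f, h_k⟩ h_0 ⊗ ⋯ (omit h_k) ⋯ ⊗ h_n`. -/
theorem annihAlg_tprod (q : ℝ) (f : H) : ∀ (n : ℕ) (h : Fin (n + 1) → H),
    annihAlg q f (tprod ℂ H (n + 1) h)
      = ∑ k : Fin (n + 1),
          ((q : ℂ) ^ (k : ℕ) * inner ℂ f (h k)) • tprod ℂ H n (fun i => h (k.succAbove i)) := by
  intro n
  induction n with
  | zero => intro h; simpa [tprod_apply] using annihAlg_ι_mul q f (h 0) 1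
  | succ n ih =>
    intro h
    have e : tprod ℂ H (n + 2) h = ι ℂ (h 0) * tprod ℂ H (n + 1) (fun i => h i.succ) := by
      simp [tprod_apply, List.ofFn_succ]
    rw [e, annihAlg_ι_mul, ih, Fin.sum_univ_succ (n := n + 1), Finset.mul_sum, Finset.smul_sum]
    congr 1
    · simp
    · refine Finset.sum_congr rfl fun k _ => ?_
      simp [tprod_apply, List.ofFn_succ, smul_smul, pow_succ]
      congr 1
      ring

theorem annihAlg_add_left (q : ℝ) (f g : H) :
    annihAlg q (f + g) = annihAlg q f + annihAlg q g := by
  ext ξ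
  induction ξ using tensor_induction with
  | one => simp
  | add a b ha hb => simp only [map_add, ha, hb]
  | smul c a ha => simp only [map_smul, ha]
  | tensor x a ha =>
    simp only [annihAlg_ι_mul, ha, LinearMap.add_apply, inner_add_left, add_smul, mul_add, smul_add]
    abel

theorem annihAlg_smul_left (q : ℝ) (c : ℂ) (f : H) :
    annihAlg q (c • f) = starRingEnd ℂ c • annihAlg q f := by
  ext ξ
  induction ξ using tensor_induction with
  | one => simp
  | add a b ha hb => simp only [map_add, ha, hb]
  | smul c a ha => simp only [map_smul, ha]
  | tensor x a ha =>
    simp only [annihAlg_ι_mul, ha, LinearMap.smul_apply, inner_smul_left, mul_smul, smul_add,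
      mul_smul_comm]
    rw [smul_comm (q : ℂ)]

/-! ### The `q`-inner product -/

/-- The opposite of the endomorphism algebra of the algebraic Fock space, on which complex scalars
act through complex conjugation. -/
def ConjEnd (H : Type*) [NormedAddCommGroup H] [InnerProductSpace ℂ H] :=
  (Module.End ℂ (TensorAlgebra ℂ H))ᵐᵒᵖ

instance : Ring (ConjEnd H) := inferInstanceAs (Ring (Module.End ℂ (TensorAlgebra ℂ H))ᵐᵒᵖ)

instance : Algebra ℂ (ConjEnd H) :=
  RingHom.toAlgebra' ((algebraMap ℂ (Module.End ℂ (TensorAlgebra ℂ H))ᵐᵒᵖ).comp (starRingEnd ℂ))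
    fun c x => Algebra.commutes (A := (Module.End ℂ (TensorAlgebra ℂ H))ᵐᵒᵖ) (starRingEnd ℂ c) x

/-- The underlying endomorphism of an element of `ConjEnd H`. -/
def ConjEnd.toEnd (x : ConjEnd H) : Module.End ℂ (TensorAlgebra ℂ H) := MulOpposite.unop x

theorem ConjEnd.toEnd_smul (c : ℂ) (x : ConjEnd H) :
    (c • x).toEnd = starRingEnd ℂ c • x.toEnd := by
  rw [Algebra.smul_def]
  ext η
  change x.toEnd (starRingEnd ℂ c • η) = _
  simp

/-- The map `g₁ ⊗ ⋯ ⊗ gₘ ↦ a(gₘ) ⋯ a(g₁)`. -/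
def annihWord (q : ℝ) : TensorAlgebra ℂ H →ₐ[ℂ] ConjEnd H :=
  lift ℂ
    { toFun := fun f => (MulOpposite.op (annihAlg q f) :
        (Module.End ℂ (TensorAlgebra ℂ H))ᵐᵒᵖ)
      map_add' := fun f g => by
        rw [annihAlg_add_left]; rfl
      map_smul' := fun c f => by
        apply MulOpposite.unop_injective
        refine Eq.trans ?_ (ConjEnd.toEnd_smul c _).symm
        rw [annihAlg_smul_left]; rfl }

/-- The form `⟨·, ·⟩_q` on the algebraic Fock space, conjugate linear in the first argument. For an
elementary tensor `g₁ ⊗ ⋯ ⊗ gₘ` it is the vacuum component of `a(gₘ) ⋯ a(g₁) η`; equivalently it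
is determined by the recursion `⟨g ⊗ ξ, η⟩_q = ⟨ξ, a(g) η⟩_q` (`qForm_ι_mul`) together with
`⟨Ω, η⟩_q = ` vacuum component of `η` (`qForm_one`). -/
def qForm (q : ℝ) (ξ η : TensorAlgebra ℂ H) : ℂ :=
  algebraMapInv ((annihWord q ξ).toEnd η)

theorem qForm_one (q : ℝ) (η : TensorAlgebra ℂ H) : qForm q 1 η = algebraMapInv η := by
  simp only [qForm, map_one]; rfl

theorem qForm_ι_mul (q : ℝ) (g : H) (ξ η : TensorAlgebra ℂ H) :
    qForm q (ι ℂ g * ξ) η = qForm q ξ (annihAlg q g η) := by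
  simp only [qForm, map_mul]
  congr 1
  change ((annihWord q ξ).toEnd * (annihWord q (ι ℂ g)).toEnd) η = _
  rw [annihWord, lift_ι_apply]; rfl

theorem qForm_add_left (q : ℝ) (ξ ξ' η : TensorAlgebra ℂ H) :
    qForm q (ξ + ξ') η = qForm q ξ η + qForm q ξ' η := by
  simp only [qForm]
  rw [map_add (annihWord q)]
  exact map_add algebraMapInv ((annihWord q ξ).toEnd η) ((annihWord q ξ').toEnd η)

theorem qForm_smul_left (q : ℝ) (c : ℂ) (ξ η : TensorAlgebra ℂ H) :
    qForm q (c • ξ) η = starRingEnd ℂ c * qForm q ξ η := by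
  simp only [qForm, map_smul, ConjEnd.toEnd_smul, LinearMap.smul_apply, smul_eq_mul]

theorem qForm_add_right (q : ℝ) (ξ η η' : TensorAlgebra ℂ H) :
    qForm q ξ (η + η') = qForm q ξ η + qForm q ξ η' := by
  simp only [qForm, map_add]

theorem qForm_smul_right (q : ℝ) (c : ℂ) (ξ η : TensorAlgebra ℂ H) :
    qForm q ξ (c • η) = c * qForm q ξ η := by
  simp only [qForm, map_smul, smul_eq_mul]

theorem qForm_zero_left (q : ℝ) (η : TensorAlgebra ℂ H) : qForm q 0 η = 0 := by
  simpa using qForm_smul_left q 0 0 η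

theorem qForm_zero_right (q : ℝ) (ξ : TensorAlgebra ℂ H) : qForm q ξ 0 = 0 := by
  simpa using qForm_smul_right q 0 ξ 0

theorem qForm_annih (q : ℝ) (f : H) (ξ : TensorAlgebra ℂ H) : ∀ η : TensorAlgebra ℂ H,
    qForm q (annihAlg q f ξ) η = qForm q ξ (ι ℂ f * η) := by
  induction ξ using tensor_induction with
  | one => intro η; simp [qForm_one, qForm_zero_left, algebraMapInv]
  | add a b ha hb => intro η; simp only [map_add, qForm_add_left, ha, hb]
  | smul c a ha => intro η; simp only [map_smul, qForm_smul_left, ha]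
  | tensor g a ha =>
    intro η
    simp only [annihAlg_ι_mul, qForm_add_left, qForm_smul_left, qForm_ι_mul, qForm_add_right,
      qForm_smul_right, ha, inner_conj_symm, Complex.conj_ofReal]

theorem qForm_conj_symm (q : ℝ) (ξ : TensorAlgebra ℂ H) : ∀ η : TensorAlgebra ℂ H,
    starRingEnd ℂ (qForm q η ξ) = qForm q ξ η := by
  induction ξ using tensor_induction with
  | one =>
    intro η
    induction η using tensor_induction with
    | one => simp [qForm_one]
    | add a b ha hb => simp only [qForm_add_left, qForm_add_right, map_add, ha, hb]
    | smul c a ha => simp [qForm_smul_left, qForm_smul_right, ha]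
    | tensor g a ha => simp [qForm_ι_mul, qForm_one, qForm_zero_right, algebraMapInv]
  | add a b ha hb => intro η; simp only [qForm_add_left, qForm_add_right, map_add, ha, hb]
  | smul c a ha => intro η; simp [qForm_smul_left, qForm_smul_right, ha]
  | tensor g a ha => intro η; rw [qForm_ι_mul, ← ha, qForm_annih]

/-! ### Positivity of the `q`-inner product for `0 ≤ q` -/

/-- The weight `q ^ (number of inversions of σ)`, where `r = √q`. -/
def permWeight (r : ℂ) {n : ℕ} (σ : Equiv.Perm (Fin n)) : ℂ :=
  ∏ a, ∏ b, if (a < b ↔ σ a < σ b) then 1 else r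

/-- The permutation of `Fin (n + 1)` sending `0` to `k` and otherwise acting as `τ`. -/
def permCons {n : ℕ} (k : Fin (n + 1)) (τ : Equiv.Perm (Fin n)) : Equiv.Perm (Fin (n + 1)) :=
  Equiv.Perm.decomposeFin.symm (0, τ) |>.trans k.cycleRange.symm

theorem permCons_zero {n : ℕ} (k : Fin (n + 1)) (τ : Equiv.Perm (Fin n)) :
    permCons k τ 0 = k := by simp [permCons]

theorem permCons_succ {n : ℕ} (k : Fin (n + 1)) (τ : Equiv.Perm (Fin n)) (i : Fin n) :
    permCons k τ i.succ = k.succAbove (τ i) := by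
  simp [permCons]

theorem permCons_bijective (n : ℕ) :
    Function.Bijective (fun p : Fin (n + 1) × Equiv.Perm (Fin n) => permCons p.1 p.2) := by
  rw [Fintype.bijective_iff_injective_and_card]
  constructor
  · rintro ⟨k, τ⟩ ⟨k', τ'⟩ h
    have h0 : k = k' := by simpa [permCons_zero] using congrArg (fun σ => σ 0) h
    subst h0
    refine Prod.ext rfl (Equiv.ext fun i => ?_)
    simpa [permCons_succ] using congrArg (fun σ => σ i.succ) h
  · simp [Fintype.card_perm, Nat.factorial_succ]

theorem prod_succAbove_weight (r : ℂ) {n : ℕ} (k : Fin (n + 1)) :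
    ∏ m : Fin n, (if k < k.succAbove m then 1 else r) = r ^ (k : ℕ) := by
  have h1 : ∀ m : Fin n, (if k < k.succAbove m then (1 : ℂ) else r)
      = if (m : ℕ) < (k : ℕ) then r else 1 := by
    intro m
    have e : k < k.succAbove m ↔ ¬ (m : ℕ) < (k : ℕ) := by
      rw [Fin.lt_succAbove_iff_le_castSucc, Fin.le_iff_val_le_val, not_lt]; rfl
    simp only [e]
    split_ifs <;> rfl
  simp_rw [h1]
  rw [Fin.prod_univ_eq_prod_range (fun m => if m < (k : ℕ) then r else 1) n, Finset.prod_ite]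
  have h2 : (Finset.range n).filter (fun m => m < (k : ℕ)) = Finset.range k := by
    ext m; have := k.2; simp; omega
  simp [h2]

theorem permWeight_cons (r : ℂ) {n : ℕ} (k : Fin (n + 1)) (τ : Equiv.Perm (Fin n)) :
    permWeight r (permCons k τ) = (r * r) ^ (k : ℕ) * permWeight r τ := by
  unfold permWeight
  rw [Fin.prod_univ_succ]
  simp_rw [Fin.prod_univ_succ (n := n), permCons_zero, permCons_succ]
  rw [Finset.prod_mul_distrib]
  have h1 : ∏ m : Fin n, (if ((0 : Fin (n + 1)) < m.succ ↔ k < k.succAbove (τ m)) then 1 else r)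
      = r ^ (k : ℕ) := by
    rw [← prod_succAbove_weight r k,
      ← Equiv.prod_comp τ (fun m => if k < k.succAbove m then (1 : ℂ) else r)]
    simp
  have h2 : ∏ m : Fin n, (if (m.succ < (0 : Fin (n + 1)) ↔ k.succAbove (τ m) < k) then 1 else r)
      = r ^ (k : ℕ) := by
    rw [← prod_succAbove_weight r k,
      ← Equiv.prod_comp τ (fun m => if k < k.succAbove m then (1 : ℂ) else r)]
    refine Finset.prod_congr rfl fun m _ => ?_
    have := Fin.succAbove_ne k (τ m)
    by_cases h : k < k.succAbove (τ m)
    · simp [h, h.le]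
    · have h' : k.succAbove (τ m) < k := lt_of_le_of_ne (not_lt.mp h) this
      simp [h, h']
  rw [h1, h2]
  simp [mul_pow, mul_assoc]

theorem qForm_tprod (q : ℝ) (r : ℂ) (hr : r * r = q) : ∀ (n : ℕ) (g h : Fin n → H),
    qForm q (tprod ℂ H n g) (tprod ℂ H n h)
      = ∑ σ : Equiv.Perm (Fin n), permWeight r σ * ∏ i, inner ℂ (g i) (h (σ i)) := by
  intro n
  induction n with
  | zero => intro g h; simp [tprod_apply, qForm_one, permWeight]
  | succ n ih =>
    intro g h
    have e : tprod ℂ H (n + 1) g = ι ℂ (g 0) * tprod ℂ H n (fun i => g i.succ) := by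
      simp [tprod_apply, List.ofFn_succ]
    have hsum : ∀ (s : Finset (Fin (n + 1))) (F : Fin (n + 1) → TensorAlgebra ℂ H) (ξ),
        qForm q ξ (∑ k ∈ s, F k) = ∑ k ∈ s, qForm q ξ (F k) := by
      intro s F ξ
      simp only [qForm, map_sum]
    rw [e, qForm_ι_mul, annihAlg_tprod, hsum, ← (permCons_bijective n).sum_comp,
      Fintype.sum_prod_type]
    refine Finset.sum_congr rfl fun k _ => ?_
    rw [qForm_smul_right, ih, Finset.mul_sum]
    refine Finset.sum_congr rfl fun τ _ => ?_
    rw [permWeight_cons, Fin.prod_univ_succ, permCons_zero, hr]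
    simp_rw [permCons_succ]
    ring

theorem qForm_tprod_of_ne (q : ℝ) : ∀ (n m : ℕ), n ≠ m → ∀ (g : Fin n → H) (h : Fin m → H),
    qForm q (tprod ℂ H n g) (tprod ℂ H m h) = 0 := by
  intro n
  induction n with
  | zero =>
    intro m hm g h
    obtain ⟨m, rfl⟩ := Nat.exists_eq_succ_of_ne_zero (Ne.symm hm)
    simp [tprod_apply, List.ofFn_succ, qForm_one, algebraMapInv]
  | succ n ih =>
    intro m hm g h
    have e : tprod ℂ H (n + 1) g = ι ℂ (g 0) * tprod ℂ H n (fun i => g i.succ) := by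
      simp [tprod_apply, List.ofFn_succ]
    rw [e, qForm_ι_mul]
    cases m with
    | zero => simp [tprod_apply, qForm_zero_right]
    | succ m =>
      rw [annihAlg_tprod]
      have hsum : ∀ (s : Finset (Fin (m + 1))) (F : Fin (m + 1) → TensorAlgebra ℂ H) (ξ),
          qForm q ξ (∑ k ∈ s, F k) = ∑ k ∈ s, qForm q ξ (F k) := by
        intro s F ξ
        simp only [qForm, map_sum]
      rw [hsum]
      refine Finset.sum_eq_zero fun k _ => ?_
      rw [qForm_smul_right, ih m (by omega), mul_zero]

open scoped ComplexOrder in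
theorem posSemidef_prod {κ α : Type*} [Finite κ] (s : Finset α) (F : α → Matrix κ κ ℂ)
    (hF : ∀ a ∈ s, (F a).PosSemidef) :
    (Matrix.of fun i j => ∏ a ∈ s, F a i j).PosSemidef := by
  classical
  induction s using Finset.induction_on with
  | empty =>
    have := Matrix.posSemidef_gram ℂ (fun _ : κ => (1 : ℂ))
    have e : (Matrix.of fun i j : κ => ∏ a ∈ (∅ : Finset α), F a i j)
        = Matrix.gram ℂ (fun _ : κ => (1 : ℂ)) := by
      ext i j; simp [Matrix.gram_apply]
    rw [e]; exact this
  | insert a s ha ih =>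
    have h1 := (hF a (by simp)).hadamard (ih fun b hb => hF b (by simp [hb]))
    have e : (Matrix.of fun i j : κ => ∏ b ∈ insert a s, F b i j)
        = (F a).hadamard (Matrix.of fun i j => ∏ b ∈ s, F b i j) := by
      ext i j; simp [Finset.prod_insert ha]
    rw [e]; exact h1

open scoped ComplexOrder in
theorem posSemidef_iff_kernel {κ : Type*} [Finite κ] (r : ℝ) (h0 : 0 ≤ r) (h1 : r ≤ 1) (p : κ → Prop)
    [DecidablePred p] :
    (Matrix.of fun i j => if (p i ↔ p j) then (1 : ℂ) else (r : ℂ)).PosSemidef := by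
  have ha := (Matrix.posSemidef_gram ℂ (fun _ : κ => (1 : ℂ))).smul
    (show (0 : ℂ) ≤ (r : ℂ) by exact_mod_cast h0)
  have hb := (Matrix.posSemidef_gram ℂ (fun i : κ => if p i then (1 : ℂ) else 0)).smul
    (show (0 : ℂ) ≤ ((1 - r : ℝ) : ℂ) by exact_mod_cast sub_nonneg.mpr h1)
  have hc := (Matrix.posSemidef_gram ℂ (fun i : κ => if p i then (0 : ℂ) else 1)).smul
    (show (0 : ℂ) ≤ ((1 - r : ℝ) : ℂ) by exact_mod_cast sub_nonneg.mpr h1)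
  have h := (ha.add hb).add hc
  refine (congrArg Matrix.PosSemidef ?_).mpr h
  ext i j
  by_cases hi : p i <;> by_cases hj : p j <;> simp [Matrix.gram_apply, hi, hj]

open scoped ComplexOrder in
/-- Positivity of the kernel `(g, h) ↦ ⟨g₁ ⊗ ⋯ ⊗ gₙ, h₁ ⊗ ⋯ ⊗ hₙ⟩_q`. -/
theorem qForm_tprod_kernel_nonneg (q : ℝ) (h0 : 0 ≤ q) (h1 : q ≤ 1) (n : ℕ)
    {κ : Type*} [Fintype κ] (g : κ → Fin n → H) (c : κ → ℂ) :
    0 ≤ (∑ i, ∑ j,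
      star (c i) * qForm q (tprod ℂ H n (g i)) (tprod ℂ H n (g j)) * c j).re := by
  classical
  set r : ℝ := √q with hr
  have hrr : (r : ℂ) * r = q := by exact_mod_cast Real.mul_self_sqrt h0
  have hr0 : 0 ≤ r := Real.sqrt_nonneg q
  have hr1 : r ≤ 1 := Real.sqrt_le_one.mpr h1
  let M : Matrix (Equiv.Perm (Fin n) × κ) (Equiv.Perm (Fin n) × κ) ℂ := fun x y =>
    (∏ a, ∏ b, if (x.1 a < x.1 b ↔ y.1 a < y.1 b) then (1 : ℂ) else (r : ℂ)) *
      ∏ a, inner ℂ (g x.2 (x.1 a)) (g y.2 (y.1 a))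
  have hM : M.PosSemidef := by
    have hA := posSemidef_prod Finset.univ
      (fun a : Fin n => Matrix.of fun x y : Equiv.Perm (Fin n) × κ =>
        ∏ b, (Matrix.of fun x y : Equiv.Perm (Fin n) × κ =>
          if (x.1 a < x.1 b ↔ y.1 a < y.1 b) then (1 : ℂ) else (r : ℂ)) x y)
      (fun a _ => posSemidef_prod Finset.univ _ fun b _ =>
        posSemidef_iff_kernel r hr0 hr1 fun x : Equiv.Perm (Fin n) × κ => x.1 a < x.1 b)
    have hB := posSemidef_prod Finset.univ
      (fun a : Fin n => Matrix.gram ℂ fun x : Equiv.Perm (Fin n) × κ => g x.2 (x.1 a))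
      (fun a _ => Matrix.posSemidef_gram ℂ _)
    exact hA.hadamard hB
  have hnn := hM.dotProduct_mulVec_nonneg (fun x => c x.2)
  have key : star (fun x : Equiv.Perm (Fin n) × κ => c x.2) ⬝ᵥ M.mulVec (fun x => c x.2)
      = (n.factorial : ℂ) *
        ∑ i, ∑ j, star (c i) * qForm q (tprod ℂ H n (g i)) (tprod ℂ H n (g j)) * c j := by
    have hk : ∀ (σ : Equiv.Perm (Fin n)) (i j : κ),
        ∑ τ : Equiv.Perm (Fin n), M (σ, i) (τ, j)
          = qForm q (tprod ℂ H n (g i)) (tprod ℂ H n (g j)) := by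
      intro σ i j
      rw [qForm_tprod q r hrr, ← Equiv.sum_comp (Equiv.mulRight σ)]
      refine Finset.sum_congr rfl fun ρ _ => ?_
      simp only [M, Equiv.coe_mulRight, Equiv.Perm.mul_apply, permWeight]
      congr 1
      · rw [← Equiv.prod_comp σ (fun a => ∏ b, if (a < b ↔ ρ a < ρ b) then (1 : ℂ) else r)]
        refine Finset.prod_congr rfl fun a _ => ?_
        rw [← Equiv.prod_comp σ (fun b => if (σ a < b ↔ ρ (σ a) < ρ b) then (1 : ℂ) else r)]
        refine Finset.prod_congr rfl fun b _ => ?_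
        congr
      · rw [← Equiv.prod_comp σ (fun m => inner ℂ (g i m) (g j (ρ m)))]
    simp only [dotProduct, Matrix.mulVec, Fintype.sum_prod_type, Pi.star_apply]
    have : ∀ (σ : Equiv.Perm (Fin n)) (i : κ),
        ∑ τ : Equiv.Perm (Fin n), ∑ j, M (σ, i) (τ, j) * c j
          = ∑ j, qForm q (tprod ℂ H n (g i)) (tprod ℂ H n (g j)) * c j := by
      intro σ i
      rw [Finset.sum_comm]
      refine Finset.sum_congr rfl fun j _ => ?_
      rw [← Finset.sum_mul, hk]
    simp_rw [this]
    simp [Fintype.card_perm, Finset.mul_sum, mul_assoc]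
  rw [key] at hnn
  have hre := (Complex.le_def.mp hnn).1
  rw [Complex.zero_re, ← Complex.ofReal_natCast, Complex.re_ofReal_mul] at hre
  have hf : (0 : ℝ) < (n.factorial : ℝ) := by exact_mod_cast n.factorial_pos
  exact (mul_nonneg_iff_of_pos_left hf).mp hre

theorem qForm_sum_left (q : ℝ) {α : Type*} (s : Finset α) (F : α → TensorAlgebra ℂ H)
    (η : TensorAlgebra ℂ H) : qForm q (∑ k ∈ s, F k) η = ∑ k ∈ s, qForm q (F k) η := by
  classical
  induction s using Finset.induction_on with
  | empty => simp [qForm_zero_left]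
  | insert a s ha ih => simp [Finset.sum_insert ha, qForm_add_left, ih]

theorem qForm_sum_right (q : ℝ) {α : Type*} (s : Finset α) (F : α → TensorAlgebra ℂ H)
    (ξ : TensorAlgebra ℂ H) : qForm q ξ (∑ k ∈ s, F k) = ∑ k ∈ s, qForm q ξ (F k) := by
  simp only [qForm, map_sum]

/-- The form `⟨·, ·⟩_q` is positive. -/
theorem qForm_self_nonneg (q : ℝ) (h0 : 0 ≤ q) (h1 : q ≤ 1) (ξ : TensorAlgebra ℂ H) :
    0 ≤ (qForm q ξ ξ).re := by
  classical
  let v : (Σ n : ℕ, Fin n → H) → TensorAlgebra ℂ H := fun p => tprod ℂ H p.1 p.2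
  have hv : ξ ∈ Submodule.span ℂ (Set.range v) := by
    induction ξ using tensor_induction with
    | one => exact Submodule.subset_span ⟨⟨0, Fin.elim0⟩, by simp [v, tprod_apply]⟩
    | add a b ha hb => exact add_mem ha hb
    | smul c a ha => exact Submodule.smul_mem _ c ha
    | tensor g a ha =>
      induction ha using Submodule.span_induction with
      | mem x hx =>
        obtain ⟨⟨n, h⟩, rfl⟩ := hx
        exact Submodule.subset_span
          ⟨⟨n + 1, Fin.cons g h⟩, by simp [v, tprod_apply, List.ofFn_succ]⟩
      | zero => simp
      | add x y _ _ hx hy => rw [mul_add]; exact add_mem hx hy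
      | smul c x _ hx => rw [mul_smul_comm]; exact Submodule.smul_mem _ c hx
  obtain ⟨c, hc⟩ := (Finsupp.mem_span_range_iff_exists_finsupp).mp hv
  let S : Finset (Σ n : ℕ, Fin n → H) := c.support
  let D : Finset ℕ := S.image Sigma.fst
  let part : ℕ → TensorAlgebra ℂ H := fun n => ∑ p ∈ S with p.1 = n, c p • v p
  have hξ : ξ = ∑ n ∈ D, part n := by
    rw [← hc, Finsupp.sum]
    exact (Finset.sum_fiberwise_of_maps_to (fun p hp => Finset.mem_image_of_mem _ hp) _).symm
  have hoff : ∀ n m, n ≠ m → qForm q (part n) (part m) = 0 := by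
    intro n m hnm
    rw [qForm_sum_left]
    refine Finset.sum_eq_zero fun p hp => ?_
    rw [qForm_sum_right]
    refine Finset.sum_eq_zero fun p' hp' => ?_
    rw [qForm_smul_left, qForm_smul_right, qForm_tprod_of_ne, mul_zero, mul_zero]
    rw [(Finset.mem_filter.mp hp).2, (Finset.mem_filter.mp hp').2]
    exact hnm
  have hdiag : ∀ n, 0 ≤ (qForm q (part n) (part n)).re := by
    intro n
    let T : Finset (Σ n : ℕ, Fin n → H) := S.filter fun p => p.1 = n
    let g : T → Fin n → H := fun p i =>
      p.1.2 (Fin.cast (Finset.mem_filter.mp p.2).2.symm i)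
    have hg : ∀ p : T, tprod ℂ H n (g p) = v p.1 := by
      rintro ⟨⟨m, h⟩, hp⟩
      obtain rfl : m = n := (Finset.mem_filter.mp hp).2
      rfl
    have hk := qForm_tprod_kernel_nonneg q h0 h1 n g (fun p : T => c p.1)
    have e : qForm q (part n) (part n)
        = ∑ i : T, ∑ j : T, star (c i.1) *
            qForm q (tprod ℂ H n (g i)) (tprod ℂ H n (g j)) * c j.1 := by
      simp only [part]
      rw [← Finset.sum_coe_sort T, qForm_sum_left]
      refine Finset.sum_congr rfl fun i _ => ?_
      rw [qForm_sum_right]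
      refine Finset.sum_congr rfl fun j _ => ?_
      rw [qForm_smul_left, qForm_smul_right, hg, hg, starRingEnd_apply]
      ring
    rw [e]
    exact hk
  rw [hξ, qForm_sum_left, Complex.re_sum]
  refine Finset.sum_nonneg fun n hn => ?_
  rw [qForm_sum_right, Finset.sum_eq_single n (fun m _ hm => hoff n m hm.symm)
    (fun h => absurd hn h)]
  exact hdiag n

theorem annihAlg_locally_nilpotent (q : ℝ) (f : H) (ξ : TensorAlgebra ℂ H) :
    ∃ N : ℕ, (annihAlg q f ^ N) ξ = 0 := by
  have mono : ∀ {N M : ℕ} {ξ : TensorAlgebra ℂ H}, N ≤ M → (annihAlg q f ^ N) ξ = 0 →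
      (annihAlg q f ^ M) ξ = 0 := by
    intro N M ξ h hN
    obtain ⟨k, rfl⟩ := Nat.exists_eq_add_of_le' h
    rw [pow_add, Module.End.mul_apply, hN, map_zero]
  have step : ∀ (g : H) (N : ℕ) (ξ : TensorAlgebra ℂ H), (annihAlg q f ^ N) ξ = 0 →
      (annihAlg q f ^ (N + 1)) (ι ℂ g * ξ) = 0 := by
    intro g N
    induction N with
    | zero => intro ξ h; simp only [pow_zero, Module.End.one_apply] at h; simp [h]
    | succ N ih =>
      intro ξ h
      have h' : (annihAlg q f ^ N) (annihAlg q f ξ) = 0 := by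
        rw [pow_succ, Module.End.mul_apply] at h; exact h
      rw [pow_succ, Module.End.mul_apply, annihAlg_ι_mul, map_add, map_smul, map_smul, h,
        ih _ h', smul_zero, smul_zero, add_zero]
  induction ξ using tensor_induction with
  | one => exact ⟨1, by simp⟩
  | add a b ha hb =>
    obtain ⟨N, hN⟩ := ha
    obtain ⟨M, hM⟩ := hb
    exact ⟨max N M, by
      rw [map_add, mono (le_max_left _ _) hN, mono (le_max_right _ _) hM, add_zero]⟩
  | smul c a ha =>
    obtain ⟨N, hN⟩ := ha
    exact ⟨N, by rw [map_smul, hN, smul_zero]⟩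
  | tensor g a ha =>
    obtain ⟨N, hN⟩ := ha
    exact ⟨N + 1, step g N a hN⟩

end Algebraic

/-! ## The `q`-Fock space -/

/-- The bound `‖a(f)^*‖ ≤ C = ‖f‖ / √(1 - q)`. -/
def qBound {H : Type*} [NormedAddCommGroup H] (q : Set.Ioo (0 : ℝ) 1) (f : H) : ℝ := ‖f‖ / √(1 - q)

theorem qBound_nonneg {H : Type*} [NormedAddCommGroup H] (q : Set.Ioo (0 : ℝ) 1)
    (f : H) : 0 ≤ qBound q f := by unfold qBound; positivity

theorem qBound_sq {H : Type*} [NormedAddCommGroup H] (q : Set.Ioo (0 : ℝ) 1) (f : H) :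
    (q : ℝ) * qBound q f ^ 2 + ‖f‖ ^ 2 = qBound q f ^ 2 := by
  have h : (0 : ℝ) < 1 - q := sub_pos.mpr q.2.2
  rw [qBound, div_pow, Real.sq_sqrt h.le]
  field_simp
  ring

section Fock

variable (q : Set.Ioo (0 : ℝ) 1) (H : Type*) [NormedAddCommGroup H] [InnerProductSpace ℂ H]

/-- The algebraic full Fock space of `H`, to be equipped with the inner product `⟨·, ·⟩_q`. -/
@[nolint unusedArguments]
def PreQFock (_q : Set.Ioo (0 : ℝ) 1) (H : Type*) [NormedAddCommGroup H]
    [InnerProductSpace ℂ H] :=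
  TensorAlgebra ℂ H

instance : AddCommGroup (PreQFock q H) := inferInstanceAs (AddCommGroup (TensorAlgebra ℂ H))

instance : Module ℂ (PreQFock q H) := inferInstanceAs (Module ℂ (TensorAlgebra ℂ H))

/-- The identity map from the tensor algebra to `PreQFock q H`. -/
def toPreQFock : TensorAlgebra ℂ H ≃ₗ[ℂ] PreQFock q H := LinearEquiv.refl ℂ _

/-- The inner product `⟨·, ·⟩_q` on the algebraic full Fock space. -/
@[reducible]
def preQFockCore : PreInnerProductSpace.Core ℂ (PreQFock q H) where
  inner ξ η := qForm q ((toPreQFock q H).symm ξ) ((toPreQFock q H).symm η)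
  conj_inner_symm ξ η := qForm_conj_symm _ _ _
  re_inner_nonneg ξ := qForm_self_nonneg _ q.2.1.le q.2.2.le _
  add_left ξ η ζ := by rw [map_add, qForm_add_left]
  smul_left ξ η c := by rw [map_smul, qForm_smul_left]

instance : SeminormedAddCommGroup (PreQFock q H) :=
  InnerProductSpace.Core.toSeminormedAddCommGroup (c := preQFockCore q H)

instance : InnerProductSpace ℂ (PreQFock q H) := InnerProductSpace.ofCore (preQFockCore q H)

/-- The `q`-Fock space over `H`: the Hilbert space completion of the algebraic full Fock space with
respect to `⟨·, ·⟩_q`. -/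
abbrev QFock := UniformSpace.Completion (PreQFock q H)

variable {H}

/-- The class in the `q`-Fock space of an element of the algebraic full Fock space. -/
def QFock.of (ξ : TensorAlgebra ℂ H) : QFock q H := ((toPreQFock q H ξ : PreQFock q H) : QFock q H)

theorem QFock.inner_of (ξ η : TensorAlgebra ℂ H) :
    inner ℂ (QFock.of q ξ) (QFock.of q η) = qForm q ξ η :=
  UniformSpace.Completion.inner_coe _ _

variable (H) in
/-- The vacuum vector `Ω = 1 ⊕ 0 ⊕ 0 ⊕ ⋯`. -/
def vacuum : QFock q H := QFock.of q 1

theorem preQFock_inner (ξ η : PreQFock q H) :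
    inner ℂ ξ η = qForm q ((toPreQFock q H).symm ξ) ((toPreQFock q H).symm η) := rfl

/-- `a(f)` on the pre-Hilbert space. -/
def preAnnih (f : H) : PreQFock q H →ₗ[ℂ] PreQFock q H :=
  (toPreQFock q H).toLinearMap ∘ₗ annihAlg q f ∘ₗ (toPreQFock q H).symm.toLinearMap

/-- `a(f)^*` on the pre-Hilbert space. -/
def preCreat (f : H) : PreQFock q H →ₗ[ℂ] PreQFock q H :=
  (toPreQFock q H).toLinearMap ∘ₗ creatAlg f ∘ₗ (toPreQFock q H).symm.toLinearMap

theorem inner_preCreat_left (f : H) (ξ η : PreQFock q H) :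
    inner ℂ (preCreat q f ξ) η = inner ℂ ξ (preAnnih q f η) :=
  qForm_ι_mul _ _ _ _

theorem inner_preAnnih_left (f : H) (ξ η : PreQFock q H) :
    inner ℂ (preAnnih q f ξ) η = inner ℂ ξ (preCreat q f η) :=
  qForm_annih _ _ _ _

theorem preAnnih_preCreat (f : H) (ξ : PreQFock q H) :
    preAnnih q f (preCreat q f ξ)
      = (inner ℂ f f : ℂ) • ξ + ((q : ℝ) : ℂ) • preCreat q f (preAnnih q f ξ) :=
  annihAlg_ι_mul _ _ _ _

theorem norm_preAnnih_of_creat (f : H) (ξ : PreQFock q H)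
    (h : ‖preCreat q f (preAnnih q f ξ)‖ ≤ qBound q f * ‖preAnnih q f ξ‖) :
    ‖preAnnih q f ξ‖ ≤ qBound q f * ‖ξ‖ := by
  have h1 : ‖preAnnih q f ξ‖ ^ 2 ≤ ‖ξ‖ * (qBound q f * ‖preAnnih q f ξ‖) := by
    rw [← inner_self_eq_norm_sq (𝕜 := ℂ), inner_preAnnih_left]
    exact (re_inner_le_norm _ _).trans (mul_le_mul_of_nonneg_left h (norm_nonneg _))
  by_contra! hlt
  have hpos : 0 < ‖preAnnih q f ξ‖ :=
    (mul_nonneg (qBound_nonneg q f) (norm_nonneg _)).trans_lt hlt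
  nlinarith

theorem norm_preCreat_sq (f : H) (ξ : PreQFock q H) :
    ‖preCreat q f ξ‖ ^ 2 = q * ‖preAnnih q f ξ‖ ^ 2 + ‖f‖ ^ 2 * ‖ξ‖ ^ 2 := by
  have h : inner ℂ (preCreat q f ξ) (preCreat q f ξ)
      = ((‖f‖ ^ 2 * ‖ξ‖ ^ 2 : ℝ) : ℂ) + ((q * ‖preAnnih q f ξ‖ ^ 2 : ℝ) : ℂ) := by
    rw [inner_preCreat_left, preAnnih_preCreat, inner_add_right, inner_smul_right,
      inner_smul_right, ← inner_preAnnih_left, inner_self_eq_norm_sq_to_K,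
      inner_self_eq_norm_sq_to_K, inner_self_eq_norm_sq_to_K]
    push_cast
    rfl
  rw [← inner_self_eq_norm_sq (𝕜 := ℂ), h, ← Complex.ofReal_add]
  exact (Complex.ofReal_re _).trans (add_comm _ _)

theorem norm_preCreat_le (f : H) (ξ : PreQFock q H) :
    ‖preCreat q f ξ‖ ≤ qBound q f * ‖ξ‖ := by
  have key : ∀ (N : ℕ) (ξ : PreQFock q H), (preAnnih q f ^ N) ξ = 0 →
      ‖preCreat q f ξ‖ ≤ qBound q f * ‖ξ‖ := by
    intro N
    induction N with
    | zero =>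
      intro ξ h
      simp only [pow_zero, Module.End.one_apply] at h
      simp [h]
    | succ N ih =>
      intro ξ h
      rw [pow_succ, Module.End.mul_apply] at h
      have h1 := norm_preAnnih_of_creat q f ξ (ih _ h)
      have h2 : ‖preAnnih q f ξ‖ ^ 2 ≤ (qBound q f * ‖ξ‖) ^ 2 :=
        pow_le_pow_left₀ (norm_nonneg _) h1 2
      have h3 : (q : ℝ) * ‖preAnnih q f ξ‖ ^ 2 ≤ q * (qBound q f * ‖ξ‖) ^ 2 :=
        mul_le_mul_of_nonneg_left h2 q.2.1.le
      refine abs_le_of_sq_le_sq' ?_ (mul_nonneg (qBound_nonneg q f) (norm_nonneg _)) |>.2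
      calc ‖preCreat q f ξ‖ ^ 2
          ≤ q * (qBound q f * ‖ξ‖) ^ 2 + ‖f‖ ^ 2 * ‖ξ‖ ^ 2 := by
            rw [norm_preCreat_sq]; linarith
        _ = ((q : ℝ) * qBound q f ^ 2 + ‖f‖ ^ 2) * ‖ξ‖ ^ 2 := by ring
        _ = (qBound q f * ‖ξ‖) ^ 2 := by rw [qBound_sq]; ring
  obtain ⟨N, hN⟩ := annihAlg_locally_nilpotent q f ((toPreQFock q H).symm ξ)
  exact key N ξ hN

theorem norm_preAnnih_le (f : H) (ξ : PreQFock q H) :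
    ‖preAnnih q f ξ‖ ≤ qBound q f * ‖ξ‖ :=
  norm_preAnnih_of_creat q f ξ (norm_preCreat_le q f _)

/-- The annihilation operator `a(f)` on the `q`-Fock space. -/
def annih (f : H) : QFock q H →L[ℂ] QFock q H :=
  ((preAnnih q f).mkContinuous (qBound q f) (norm_preAnnih_le q f)).completion

/-- The creation operator `a(f)^*` on the `q`-Fock space. -/
def creat (f : H) : QFock q H →L[ℂ] QFock q H :=
  ((preCreat q f).mkContinuous (qBound q f) (norm_preCreat_le q f)).completion

theorem annih_of (f : H) (ξ : TensorAlgebra ℂ H) :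
    annih q f (QFock.of q ξ) = QFock.of q (annihAlg q f ξ) :=
  ContinuousLinearMap.completion_apply_coe _ _

theorem creat_of (f : H) (ξ : TensorAlgebra ℂ H) :
    creat q f (QFock.of q ξ) = QFock.of q (ι ℂ f * ξ) :=
  ContinuousLinearMap.completion_apply_coe _ _

/-- `a(f)^*` is the adjoint of `a(f)`. -/
theorem adjoint_annih (f : H) : (annih q f).adjoint = creat q f := by
  symm
  rw [ContinuousLinearMap.eq_adjoint_iff]
  intro x y
  induction x, y using UniformSpace.Completion.induction_on₂ with
  | hp => exact isClosed_eq (by fun_prop) (by fun_prop)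
  | ih ξ η =>
    have h : ∀ a b : TensorAlgebra ℂ H, inner ℂ (creat q f (QFock.of q a)) (QFock.of q b)
        = inner ℂ (QFock.of q a) (annih q f (QFock.of q b)) := by
      intro a b
      rw [creat_of, annih_of, QFock.inner_of, QFock.inner_of, qForm_ι_mul]
    exact h ((toPreQFock q H).symm ξ) ((toPreQFock q H).symm η)

/-- The `q`-Gaussian random variable `X(f) = a(f) + a(f)^*`. -/
def qGauss (f : H) : QFock q H →L[ℂ] QFock q H := annih q f + creat q f

theorem isSelfAdjoint_qGauss (f : H) : IsSelfAdjoint (qGauss q f) := by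
  rw [IsSelfAdjoint, ContinuousLinearMap.star_eq_adjoint, qGauss, map_add, ← adjoint_annih,
    ContinuousLinearMap.adjoint_adjoint, add_comm]

end Fock

/-! ## Distributions -/

section Distribution

variable {E : Type*} [NormedAddCommGroup E] [InnerProductSpace ℂ E] [CompleteSpace E]

/-- The functional `φ ↦ ⟨v, φ(T) v⟩` on compactly supported continuous functions. -/
def distFunctional (v : E) (T : E →L[ℂ] E) :
    CompactlySupportedContinuousMap ℝ ℝ →ₚ[ℝ] ℝ :=
  PositiveLinearMap.mk₀
    { toFun := fun φ => (inner ℂ v (cfc (fun x => φ x) T v)).re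
      map_add' := fun φ ψ => by
        simp only [CompactlySupportedContinuousMap.add_apply]
        rw [cfc_add T (fun x => φ x) (fun x => ψ x) (φ.continuous.continuousOn)
          (ψ.continuous.continuousOn)]
        simp
      map_smul' := fun c φ => by
        simp only [CompactlySupportedContinuousMap.smul_apply]
        rw [cfc_smul c (fun x => φ x) T (φ.continuous.continuousOn), RingHom.id_apply,
          smul_apply, ← Complex.coe_smul, inner_smul_right,
          Complex.re_ofReal_mul]
        rfl }
    fun φ hφ => by
      have h : 0 ≤ cfc (fun x => φ x) T := cfc_nonneg fun x _ => hφ x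
      exact ((ContinuousLinearMap.nonneg_iff_isPositive _).mp h).re_inner_nonneg_right v

/-- The distribution of the bounded self-adjoint operator `T` in the vector state `⟨v, · v⟩`: the
Borel measure `μ` on `ℝ` with `∫ φ dμ = ⟨v, φ(T) v⟩` for all compactly supported continuous `φ`. -/
def distIn (v : E) (T : E →L[ℂ] E) : MeasureTheory.Measure ℝ :=
  RealRMK.rieszMeasure (distFunctional v T)

theorem integral_distIn (v : E) (T : E →L[ℂ] E) (φ : CompactlySupportedContinuousMap ℝ ℝ) :
    ∫ x, φ x ∂(distIn v T) = (inner ℂ v (cfc (fun x => φ x) T v)).re :=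
  RealRMK.integral_rieszMeasure (distFunctional v T) φ

end Distribution

section Vacuum

variable (q : Set.Ioo (0 : ℝ) 1) {H : Type*} [NormedAddCommGroup H] [InnerProductSpace ℂ H]

/-- The vacuum distribution of a bounded self-adjoint operator on the `q`-Fock space. -/
def vacuumDist (T : QFock q H →L[ℂ] QFock q H) : MeasureTheory.Measure ℝ := distIn (vacuum q H) T

/-- The vacuum expectation `⟨Ω, T Ω⟩_q`. -/
def vacuumExp (T : QFock q H →L[ℂ] QFock q H) : ℂ := inner ℂ (vacuum q H) (T (vacuum q H))

end Vacuum

end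

/-! Write `f`, `g` for the two orthogonal unit vectors and `Y = γ(X(f))`. Applying `Y` to `Ω` gives
`∑ c_i f^i` (an infinite sum in general), and applying it to `g` gives `∑ c_i f^i ⊗ g` with the same
coefficients, because annihilating by `f` does not see a final letter `g`. Expanding `(Y + X(g))^2
Ω` shows that the fourth moment is `‖Y²Ω‖² + 4‖YΩ‖² + (2 + q)` plus twice the real part of the
crossing term `⟨g ⊗ YΩ, Y g⟩` (`vacuumExp_cfc_add_qGauss_pow_four`). All terms but the last depend
only on the law of `Y`. The crossing term is `∑ q^i |c_i|² [i]_q!`, since annihilating the last `g`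
in `f^i ⊗ g` passes over `i` letters.

If `Y` has the law of `X(f)`, then `c_0 = 0` and `∑ |c_i|² [i]_q! = 1`. Hence the crossing term is
at most `q² + (q - q²) |c_1|²` (`re_inner_creat_cfc_le`), and this is less than `q` unless `|c_1| =
1`, that is, unless `γ` is `x` or `-x` almost everywhere. So any other continuous map `γ` preserving
the law lowers the fourth moment strictly (`re_vacuumExp_pow_four_lt`).

Such a map is the tent map conjugated by the distribution function of the law
(`exists_folding_map`). For it to be continuous the law must have no atoms and must charge every
open subinterval of `(-r, r)`, where `r = 2 / √(1 - q)`. Both facts come from the orthogonal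
polynomials of the law, the `q`-Hermite polynomials (`noAtoms_of_orthogonal`,
`measure_Ioo_ne_zero_of_orthogonal`), so no explicit density is needed. The tools are the
Christoffel–Darboux identity and a Turán-type quadratic form that grows by an explicit nonnegative
increment (`turan_succ`). -/

noncomputable section

open TensorAlgebra

/-! ### Laws of bounded self-adjoint operators and the continuous functional calculus -/

section DistributionCalculus

open MeasureTheory Set

variable {E : Type*} [NormedAddCommGroup E] [InnerProductSpace ℂ E] [CompleteSpace E]

instance regular_distIn (v : E) (T : E →L[ℂ] E) : (distIn v T).Regular :=
  RealRMK.regular_rieszMeasure _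

theorem exists_cutoff (r : ℝ) (g : ℝ → ℝ) (hg : Continuous g) :
    ∃ φ : CompactlySupportedContinuousMap ℝ ℝ, ∀ x ∈ Icc (-r) r, φ x = g x := by
  obtain ⟨χ, h1, -, hc, -⟩ := exists_continuous_one_zero_of_isCompact
    (isCompact_Icc (a := -r) (b := r)) isClosed_empty (by simp)
  refine ⟨⟨⟨fun x => χ x * g x, by fun_prop⟩, hc.mul_right⟩, fun x hx => ?_⟩
  have : χ x = 1 := h1 hx
  change χ x * g x = g x
  rw [this, one_mul]

/-- A bump function equal to 1 on a compact set off the interval vanishes on the spectrum, so its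
functional calculus is 0; inner regularity then passes from compact sets to the open complement. -/
theorem distIn_compl_Icc (v : E) (T : E →L[ℂ] E) {r : ℝ} (hr : spectrum ℝ T ⊆ Icc (-r) r) :
    distIn v T (Icc (-r) r)ᶜ = 0 := by
  have ho : IsOpen (Icc (-r) r)ᶜ := isClosed_Icc.isOpen_compl
  rw [ho.measure_eq_iSup_isCompact]
  simp only [ENNReal.iSup_eq_zero]
  intro K hK hc
  obtain ⟨χ, h1, h0, hcs, hχ⟩ := exists_continuous_one_zero_of_isCompact hc
    (isClosed_Icc (a := -r) (b := r)) (disjoint_compl_right_iff_subset.mpr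
      (by simpa using hK) |>.mono_right (by simp))
  let φ : CompactlySupportedContinuousMap ℝ ℝ := ⟨χ, hcs⟩
  have hle : distIn v T K ≤ ENNReal.ofReal (distFunctional v T φ) := by
    refine RealRMK.rieszMeasure_le_of_eq_one (distFunctional v T) (f := φ) ?_ hc ?_
    · intro x; exact (hχ x).1
    · intro x hx; exact h1 hx
  have hz : distFunctional v T φ = 0 := by
    have : cfc (fun x => φ x) T = 0 := by
      rw [← cfc_zero ℝ T]
      exact cfc_congr fun x hx => h0 (hr hx)
    change (inner ℂ v (cfc (fun x => φ x) T v)).re = 0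
    simp [this]
  rw [hz] at hle
  simpa using hle

theorem exists_spectrum_subset_Icc (T : E →L[ℂ] E) : ∃ r, spectrum ℝ T ⊆ Icc (-r) r := by
  -- The factor `‖1‖` stays because `E` may be the zero space, where it is not 1.
  refine ⟨‖T‖ * ‖(1 : E →L[ℂ] E)‖, fun x hx => ?_⟩
  have := spectrum.norm_le_norm_mul_of_mem hx
  exact abs_le.mp this

instance finite_distIn (v : E) (T : E →L[ℂ] E) : IsFiniteMeasure (distIn v T) := by
  obtain ⟨r, hr⟩ := exists_spectrum_subset_Icc T
  refine ⟨?_⟩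
  rw [← union_compl_self (Icc (-r) r)]
  refine (measure_union_le _ _).trans_lt ?_
  rw [distIn_compl_Icc v T hr, add_zero]
  exact isCompact_Icc.measure_lt_top

theorem ae_mem_Icc_distIn (v : E) (T : E →L[ℂ] E) {r : ℝ} (hr : spectrum ℝ T ⊆ Icc (-r) r) :
    ∀ᵐ x ∂(distIn v T), x ∈ Icc (-r) r :=
  distIn_compl_Icc v T hr

theorem integrable_distIn (v : E) (T : E →L[ℂ] E) {g : ℝ → ℝ} (hg : Continuous g) :
    Integrable g (distIn v T) := by
  obtain ⟨r, hr⟩ := exists_spectrum_subset_Icc T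
  rw [← Measure.restrict_eq_self_of_ae_mem (ae_mem_Icc_distIn v T hr)]
  exact hg.continuousOn.integrableOn_compact isCompact_Icc

theorem integral_distIn_of_continuous (v : E) (T : E →L[ℂ] E) {g : ℝ → ℝ} (hg : Continuous g) :
    ∫ x, g x ∂(distIn v T) = (inner ℂ v (cfc g T v)).re := by
  obtain ⟨r, hr⟩ := exists_spectrum_subset_Icc T
  obtain ⟨φ, hφ⟩ := exists_cutoff r g hg
  have h1 : ∫ x, g x ∂(distIn v T) = ∫ x, φ x ∂(distIn v T) := by
    refine integral_congr_ae ?_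
    filter_upwards [ae_mem_Icc_distIn v T hr] with x hx using (hφ x hx).symm
  rw [h1, integral_distIn]
  rw [cfc_congr (g := g) fun x hx => hφ x (hr hx)]

theorem distIn_cfc (v : E) {T : E →L[ℂ] E} (hT : IsSelfAdjoint T) {γ : ℝ → ℝ}
    (hγ : Continuous γ) : distIn v (cfc γ T) = (distIn v T).map γ := by
  refine Measure.ext_of_integral_eq_on_compactlySupported fun f => ?_
  rw [integral_distIn]
  refine Eq.trans ?_ (integral_map hγ.aemeasurable (f.continuous.aestronglyMeasurable)).symm
  refine Eq.trans ?_
    (integral_distIn_of_continuous v T (g := fun x => f (γ x)) (f.continuous.comp hγ)).symm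
  rw [← cfc_comp' (fun x => f x) γ T f.continuous.continuousOn hγ.continuousOn hT]

theorem integral_mul_distIn (v : E) {T : E →L[ℂ] E} {g k : ℝ → ℝ}
    (hg : Continuous g) (hk : Continuous k) :
    ∫ x, g x * k x ∂(distIn v T) = (inner ℂ (cfc g T v) (cfc k T v)).re := by
  refine (integral_distIn_of_continuous v T (hg.mul hk)).trans ?_
  change (inner ℂ v (cfc (fun x => g x * k x) T v)).re = _
  rw [cfc_mul g k T hg.continuousOn hk.continuousOn, mul_apply_eq_comp]
  have : (cfc g T).adjoint = cfc g T := (cfc_predicate g T : IsSelfAdjoint _)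
  rw [← ContinuousLinearMap.adjoint_inner_left, this]

/-- Weierstrass approximation on an interval containing the spectrum: any closed condition on
operators may be checked on polynomials in `T`. -/
theorem cfc_mem_of_isClosed {T : E →L[ℂ] E} (hT : IsSelfAdjoint T) {γ : ℝ → ℝ}
    (hγ : Continuous γ) {S : Set (E →L[ℂ] E)} (hS : IsClosed S)
    (h : ∀ p : Polynomial ℝ, Polynomial.aeval T p ∈ S) : cfc γ T ∈ S := by
  obtain ⟨r, hr⟩ := exists_spectrum_subset_Icc T
  rw [← hS.closure_eq, Metric.mem_closure_iff]
  intro ε hε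
  obtain ⟨p, hp⟩ := exists_polynomial_near_of_continuousOn (-r) r γ hγ.continuousOn (ε / 2)
    (by positivity)
  refine ⟨_, h p, ?_⟩
  rw [dist_eq_norm, ← cfc_polynomial p T hT, ← cfc_sub γ p.eval T hγ.continuousOn
    p.continuous.continuousOn]
  refine (norm_cfc_le (by positivity) fun x hx => ?_).trans_lt (half_lt_self hε)
  rw [Real.norm_eq_abs, abs_sub_comm]
  exact (hp x (hr hx)).le

end DistributionCalculus

/-- The `q`-integer `1 + q + ⋯ + q ^ (n - 1)`. -/
def qInt (q : ℝ) : ℕ → ℝ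
  | 0 => 0
  | n + 1 => 1 + q * qInt q n

/-- The `q`-factorial. -/
def qFact (q : ℝ) : ℕ → ℝ
  | 0 => 1
  | n + 1 => qInt q (n + 1) * qFact q n

/-! ### The `q`-inner product on words in two orthogonal letters -/

section Words

variable {H : Type*} [NormedAddCommGroup H] [InnerProductSpace ℂ H]

/-- The last letter is reached after all the others and is orthogonal to `f`, so it contributes no
term and shifts no power of `q`. -/
theorem annihAlg_mul_ι (q : ℝ) {f g : H} (hfg : inner ℂ f g = 0) (ξ : TensorAlgebra ℂ H) :
    annihAlg q f (ξ * ι ℂ g) = annihAlg q f ξ * ι ℂ g := by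
  induction ξ using tensor_induction with
  | one => simpa [hfg] using annihAlg_ι_mul q f g 1
  | add a b ha hb => simp [add_mul, ha, hb]
  | smul c a ha => simp [ha]
  | tensor x a ha =>
    rw [mul_assoc, annihAlg_ι_mul, annihAlg_ι_mul, ha, add_mul, smul_mul_assoc, smul_mul_assoc,
      mul_assoc]

/-- Each orthogonal letter passed over costs a factor `q`. These factors are the weights of the
crossing term. -/
theorem annihAlg_pow_mul (q : ℝ) {f g : H} (hfg : inner ℂ f g = 0) (n : ℕ)
    (ξ : TensorAlgebra ℂ H) :
    annihAlg q f (ι ℂ g ^ n * ξ) = (q : ℂ) ^ n • (ι ℂ g ^ n * annihAlg q f ξ) := by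
  induction n with
  | zero => simp
  | succ n ih =>
    rw [pow_succ', mul_assoc, annihAlg_ι_mul, hfg, ih, zero_smul, zero_add, mul_smul_comm,
      smul_smul, pow_succ', mul_assoc]

theorem annihAlg_ι (q : ℝ) (f g : H) :
    annihAlg q f (ι ℂ g) = algebraMap ℂ _ (inner ℂ f g) := by
  simpa [Algebra.algebraMap_eq_smul_one] using annihAlg_ι_mul q f g 1

theorem annihAlg_pow_of_orthogonal (q : ℝ) {f g : H} (hfg : inner ℂ f g = 0) (n : ℕ) :
    annihAlg q f (ι ℂ g ^ n) = 0 := by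
  simpa using annihAlg_pow_mul q hfg n 1

theorem annihAlg_pow_self (q : ℝ) {f : H} (hf : ‖f‖ = 1) (n : ℕ) :
    annihAlg q f (ι ℂ f ^ (n + 1)) = (qInt q (n + 1) : ℂ) • ι ℂ f ^ n := by
  have hff : inner ℂ f f = 1 := by simp [inner_self_eq_norm_sq_to_K, hf]
  induction n with
  | zero => simp [annihAlg_ι, hf, qInt]
  | succ n ih =>
    rw [pow_succ', annihAlg_ι_mul, ih, hff, mul_smul_comm, ← pow_succ', smul_smul, ← add_smul]
    congr 1
    simp [qInt]

theorem qForm_pow_pow (q : ℝ) {f : H} (hf : ‖f‖ = 1) (m : ℕ) : ∀ n : ℕ,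
    qForm q (ι ℂ f ^ m) (ι ℂ f ^ n) = if m = n then (qFact q n : ℂ) else 0 := by
  induction m with
  | zero =>
    rintro (_ | n)
    · simp [qForm_one, qFact]
    · simp [qForm_one, algebraMapInv]
  | succ m ih =>
    rintro (_ | n)
    · rw [pow_succ', qForm_ι_mul]
      simp [qForm_zero_right]
    · rw [pow_succ', qForm_ι_mul, annihAlg_pow_self q hf, qForm_smul_right, ih]
      by_cases h : m = n <;> simp [h, qFact]

theorem qForm_pow_sum (q : ℝ) {f : H} (hf : ‖f‖ = 1) {m N : ℕ} (hm : m < N) (c : ℕ → ℂ) :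
    qForm q (ι ℂ f ^ m) (∑ i ∈ Finset.range N, c i • ι ℂ f ^ i) = c m * qFact q m := by
  rw [qForm_sum_right, Finset.sum_eq_single m]
  · rw [qForm_smul_right, qForm_pow_pow q hf, if_pos rfl]
  · intro i _ hi
    rw [qForm_smul_right, qForm_pow_pow q hf, if_neg hi.symm, mul_zero]
  · simp [hm]

theorem qForm_sum_sum (q : ℝ) {f : H} (hf : ‖f‖ = 1) (N : ℕ) (c d : ℕ → ℂ) :
    qForm q (∑ i ∈ Finset.range N, c i • ι ℂ f ^ i) (∑ i ∈ Finset.range N, d i • ι ℂ f ^ i)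
      = ∑ i ∈ Finset.range N, starRingEnd ℂ (c i) * d i * qFact q i := by
  rw [qForm_sum_left]
  refine Finset.sum_congr rfl fun i hi => ?_
  rw [qForm_smul_left, qForm_pow_sum q hf (Finset.mem_range.mp hi), mul_assoc]

/-- Appending `g` on the right preserves the Gram matrix of the powers of `f`; this makes `Y g` and
`YΩ` equally long. -/
theorem qForm_pow_mul_pow_mul (q : ℝ) {f g : H} (hf : ‖f‖ = 1) (hg : ‖g‖ = 1)
    (hfg : inner ℂ f g = 0) (m : ℕ) : ∀ n : ℕ,
    qForm q (ι ℂ f ^ m * ι ℂ g) (ι ℂ f ^ n * ι ℂ g) = if m = n then (qFact q n : ℂ) else 0 := by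
  have hgf : inner ℂ g f = 0 := inner_eq_zero_symm.mp hfg
  have hgg : inner ℂ g g = 1 := by simp [inner_self_eq_norm_sq_to_K, hg]
  induction m with
  | zero =>
    intro n
    rw [pow_zero, one_mul, ← mul_one (ι ℂ g), qForm_ι_mul, mul_one, annihAlg_pow_mul q hgf,
      annihAlg_ι, hgg, map_one, mul_one, qForm_smul_right]
    have := qForm_pow_pow q hf 0 n
    rw [pow_zero] at this
    rw [this]
    by_cases h : 0 = n
    · simp [← h]
    · simp [h]
  | succ m ih =>
    rintro (_ | n)
    · rw [pow_succ', mul_assoc, qForm_ι_mul, annihAlg_mul_ι q hfg]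
      simp [qForm_zero_right]
    · rw [pow_succ', mul_assoc, qForm_ι_mul, annihAlg_mul_ι q hfg, annihAlg_pow_self q hf,
        smul_mul_assoc, qForm_smul_right, ih]
      by_cases h : m = n <;> simp [h, qFact]

end Words

/-! ### Functions of one `q`-Gaussian acting on the vacuum and on an orthogonal letter -/

section PairOfGaussians

variable (q : Set.Ioo (0 : ℝ) 1) {H : Type*} [NormedAddCommGroup H] [InnerProductSpace ℂ H]

@[simp] theorem QFock.of_add (ξ η : TensorAlgebra ℂ H) :
    QFock.of q (ξ + η) = QFock.of q ξ + QFock.of q η := by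
  rw [QFock.of, map_add, UniformSpace.Completion.coe_add]; rfl

@[simp] theorem QFock.of_smul (c : ℂ) (ξ : TensorAlgebra ℂ H) :
    QFock.of q (c • ξ) = c • QFock.of q ξ := by
  simp [QFock.of]

@[simp] theorem QFock.of_zero : QFock.of q (0 : TensorAlgebra ℂ H) = 0 := by
  simpa using QFock.of_smul q (0 : ℂ) (0 : TensorAlgebra ℂ H)

theorem qGauss_of (f : H) (ξ : TensorAlgebra ℂ H) :
    qGauss q f (QFock.of q ξ) = QFock.of q (annihAlg q f ξ + ι ℂ f * ξ) := by
  rw [qGauss, add_apply, annih_of, creat_of, QFock.of_add]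

theorem exists_aeval_annihAlg {f : H} (hf : ‖f‖ = 1) (P : Polynomial ℂ) :
    ∃ Q : Polynomial ℂ, annihAlg q f (Polynomial.aeval (ι ℂ f) P) = Polynomial.aeval (ι ℂ f) Q := by
  induction P using Polynomial.induction_on' with
  | add P₁ P₂ h₁ h₂ =>
    obtain ⟨Q₁, h₁⟩ := h₁
    obtain ⟨Q₂, h₂⟩ := h₂
    exact ⟨Q₁ + Q₂, by simp [h₁, h₂]⟩
  | monomial n a =>
    rcases n with _ | n
    · exact ⟨0, by simp [Algebra.algebraMap_eq_smul_one]⟩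
    · refine ⟨Polynomial.monomial n (a * qInt q (n + 1)), ?_⟩
      simp only [Polynomial.aeval_monomial, ← Algebra.smul_def, map_smul, annihAlg_pow_self _ hf,
        smul_smul]

/-- The point is that one and the same `P` serves both vectors: `X(f)` acts on `f^n ⊗ g` as it does
on `f^n`, the final `g` being inert. -/
theorem exists_aeval_qGauss {f g : H} (hf : ‖f‖ = 1) (hfg : inner ℂ f g = 0)
    (p : Polynomial ℝ) : ∃ P : Polynomial ℂ,
      Polynomial.aeval (qGauss q f) p (vacuum q H) = QFock.of q (Polynomial.aeval (ι ℂ f) P) ∧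
      Polynomial.aeval (qGauss q f) p (QFock.of q (ι ℂ g))
        = QFock.of q (Polynomial.aeval (ι ℂ f) P * ι ℂ g) := by
  induction p using Polynomial.induction_on' with
  | add p₁ p₂ h₁ h₂ =>
    obtain ⟨P₁, h₁, h₁'⟩ := h₁
    obtain ⟨P₂, h₂, h₂'⟩ := h₂
    exact ⟨P₁ + P₂, by simp [h₁, h₂], by simp [h₁', h₂', add_mul]⟩
  | monomial n a =>
    have key : ∃ P : Polynomial ℂ,
        (qGauss q f ^ n) (vacuum q H) = QFock.of q (Polynomial.aeval (ι ℂ f) P) ∧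
        (qGauss q f ^ n) (QFock.of q (ι ℂ g))
          = QFock.of q (Polynomial.aeval (ι ℂ f) P * ι ℂ g) := by
      induction n with
      | zero => exact ⟨1, by simp [vacuum], by simp⟩
      | succ n ih =>
        obtain ⟨P, h, h'⟩ := ih
        obtain ⟨Q, hQ⟩ := exists_aeval_annihAlg q hf P
        refine ⟨Q + Polynomial.X * P, ?_, ?_⟩
        · rw [pow_succ', mul_apply_eq_comp, h, qGauss_of, hQ]
          simp
        · rw [pow_succ', mul_apply_eq_comp, h', qGauss_of,
            annihAlg_mul_ι _ hfg, hQ]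
          simp [add_mul, mul_assoc]
    obtain ⟨P, h, h'⟩ := key
    refine ⟨Polynomial.C (a : ℂ) * P, ?_, ?_⟩
    · rw [Polynomial.aeval_monomial, ← Algebra.smul_def, smul_apply, h, map_mul,
        Polynomial.aeval_C, ← Algebra.smul_def, QFock.of_smul, Complex.coe_smul]
    · rw [Polynomial.aeval_monomial, ← Algebra.smul_def, smul_apply, h', map_mul,
        Polynomial.aeval_C, ← Algebra.smul_def, smul_mul_assoc, QFock.of_smul, Complex.coe_smul]

/-- Reduction device for all later statements about `γ(X(f))`: a closed condition need only be
verified for operators with a common finite expansion on `Ω` and on `g`. -/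
theorem cfc_qGauss_mem {f g : H} (hf : ‖f‖ = 1) (hfg : inner ℂ f g = 0)
    {γ : ℝ → ℝ} (hγ : Continuous γ) {S : Set (QFock q H →L[ℂ] QFock q H)} (hS : IsClosed S)
    (h : ∀ (T : QFock q H →L[ℂ] QFock q H) (N : ℕ) (c : ℕ → ℂ), 2 ≤ N →
      T (vacuum q H) = QFock.of q (∑ i ∈ Finset.range N, c i • ι ℂ f ^ i) →
      T (QFock.of q (ι ℂ g)) = QFock.of q ((∑ i ∈ Finset.range N, c i • ι ℂ f ^ i) * ι ℂ g) →
      T ∈ S) : cfc γ (qGauss q f) ∈ S := by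
  refine cfc_mem_of_isClosed (isSelfAdjoint_qGauss q f) hγ hS fun p => ?_
  obtain ⟨P, h₁, h₂⟩ := exists_aeval_qGauss q hf hfg p
  -- Padding the degree to length at least 2 makes the coefficients of `f^0` and `f^1` always
  -- present in the sum.
  rw [Polynomial.aeval_eq_sum_range' (show P.natDegree < P.natDegree + 2 by omega)] at h₁ h₂
  exact h _ _ _ (by omega) h₁ h₂

theorem annih_cfc_vacuum {f g : H} (hf : ‖f‖ = 1) (hfg : inner ℂ f g = 0)
    {γ : ℝ → ℝ} (hγ : Continuous γ) : annih q g (cfc γ (qGauss q f) (vacuum q H)) = 0 := by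
  refine cfc_qGauss_mem q (S := {T | annih q g (T (vacuum q H)) = 0}) hf hfg hγ
    (isClosed_eq (by fun_prop) (by fun_prop)) fun T N c _ h _ => ?_
  rw [Set.mem_ofPred_eq, h, annih_of, map_sum]
  simp [annihAlg_pow_of_orthogonal _ (inner_eq_zero_symm.mp hfg)]

theorem annihAlg_sum_mul_ι {f g : H} (hg : ‖g‖ = 1) (hfg : inner ℂ f g = 0)
    (N : ℕ) (c : ℕ → ℂ) :
    annihAlg q g ((∑ i ∈ Finset.range N, c i • ι ℂ f ^ i) * ι ℂ g)
      = ∑ i ∈ Finset.range N, (c i * ((q : ℝ) : ℂ) ^ i) • ι ℂ f ^ i := by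
  rw [Finset.sum_mul, map_sum]
  refine Finset.sum_congr rfl fun i _ => ?_
  rw [smul_mul_assoc, map_smul, annihAlg_pow_mul _ (inner_eq_zero_symm.mp hfg), annihAlg_ι,
    inner_self_eq_norm_sq_to_K, hg, smul_smul]
  simp

theorem annih_annih_cfc {f g : H} (hf : ‖f‖ = 1) (hg : ‖g‖ = 1) (hfg : inner ℂ f g = 0)
    {γ : ℝ → ℝ} (hγ : Continuous γ) :
    annih q g (annih q g (cfc γ (qGauss q f) (QFock.of q (ι ℂ g)))) = 0 := by
  refine cfc_qGauss_mem q (S := {T | annih q g (annih q g (T (QFock.of q (ι ℂ g)))) = 0})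
    hf hfg hγ (isClosed_eq (by fun_prop) (by fun_prop)) fun T N c _ _ h => ?_
  rw [Set.mem_ofPred_eq, h, annih_of, annih_of, annihAlg_sum_mul_ι q hg hfg, map_sum]
  simp [annihAlg_pow_of_orthogonal _ (inner_eq_zero_symm.mp hfg)]

theorem norm_cfc_apply_ι {f g : H} (hf : ‖f‖ = 1) (hg : ‖g‖ = 1) (hfg : inner ℂ f g = 0)
    {γ : ℝ → ℝ} (hγ : Continuous γ) :
    ‖cfc γ (qGauss q f) (QFock.of q (ι ℂ g))‖ = ‖cfc γ (qGauss q f) (vacuum q H)‖ := by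
  refine cfc_qGauss_mem q (S := {T | ‖T (QFock.of q (ι ℂ g))‖ = ‖T (vacuum q H)‖})
    hf hfg hγ (isClosed_eq (by fun_prop) (by fun_prop)) fun T N c _ h h' => ?_
  rw [Set.mem_ofPred_eq, h, h', ← sq_eq_sq₀ (norm_nonneg _) (norm_nonneg _),
    ← inner_self_eq_norm_sq (𝕜 := ℂ), ← inner_self_eq_norm_sq (𝕜 := ℂ), QFock.inner_of,
    QFock.inner_of, qForm_sum_sum _ hf, Finset.sum_mul, qForm_sum_left]
  congr 1
  refine Finset.sum_congr rfl fun i hi => ?_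
  rw [smul_mul_assoc, qForm_smul_left, qForm_sum_right, Finset.sum_eq_single i, smul_mul_assoc,
    qForm_smul_right, qForm_pow_mul_pow_mul _ hf hg hfg, if_pos rfl, mul_assoc]
  · intro j _ hj
    rw [smul_mul_assoc, qForm_smul_right, qForm_pow_mul_pow_mul _ hf hg hfg, if_neg hj.symm,
      mul_zero]
  · exact fun h => absurd hi h

theorem qInt_nonneg (n : ℕ) : 0 ≤ qInt q n := by
  induction n with
  | zero => exact le_rfl
  | succ n ih => have := q.2.1; simp only [qInt]; positivity

theorem qFact_nonneg (n : ℕ) : 0 ≤ qFact q n := by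
  induction n with
  | zero => exact zero_le_one
  | succ n ih => exact mul_nonneg (qInt_nonneg q _) ih

/-- For a finite expansion the left side is `∑ q^i |c_i|² [i]_q!`. Keeping the terms `i = 0, 1`
exactly and using `q^i ≤ q²` for `i ≥ 2` gives the right side. An inequality in this form is closed
under norm limits. -/
theorem re_inner_creat_cfc_le {f g : H} (hf : ‖f‖ = 1) (hg : ‖g‖ = 1) (hfg : inner ℂ f g = 0)
    {γ : ℝ → ℝ} (hγ : Continuous γ) :
    (inner ℂ (creat q g (cfc γ (qGauss q f) (vacuum q H)))
        (cfc γ (qGauss q f) (QFock.of q (ι ℂ g)))).re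
      ≤ (1 - (q : ℝ) ^ 2) * ‖inner ℂ (vacuum q H) (cfc γ (qGauss q f) (vacuum q H))‖ ^ 2
        + ((q : ℝ) - (q : ℝ) ^ 2)
          * ‖inner ℂ (QFock.of q (ι ℂ f)) (cfc γ (qGauss q f) (vacuum q H))‖ ^ 2
        + (q : ℝ) ^ 2 * ‖cfc γ (qGauss q f) (vacuum q H)‖ ^ 2 := by
  refine cfc_qGauss_mem q (S := {T | (inner ℂ (creat q g (T (vacuum q H)))
        (T (QFock.of q (ι ℂ g)))).re
      ≤ (1 - (q : ℝ) ^ 2) * ‖inner ℂ (vacuum q H) (T (vacuum q H))‖ ^ 2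
        + ((q : ℝ) - (q : ℝ) ^ 2)
          * ‖inner ℂ (QFock.of q (ι ℂ f)) (T (vacuum q H))‖ ^ 2
        + (q : ℝ) ^ 2 * ‖T (vacuum q H)‖ ^ 2})
    hf hfg hγ (isClosed_le (by fun_prop) (by fun_prop)) fun T N c hN h h' => ?_
  have e0 := qForm_pow_sum q hf (show 0 < N by omega) c
  have e1 := qForm_pow_sum q hf (show 1 < N by omega) c
  rw [pow_zero] at e0
  rw [pow_one] at e1
  rw [Set.mem_ofPred_eq, h, h', ← inner_self_eq_norm_sq (𝕜 := ℂ) (QFock.of q _), creat_of,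
    vacuum, QFock.inner_of, QFock.inner_of, QFock.inner_of, QFock.inner_of, e0, e1, qForm_ι_mul,
    annihAlg_sum_mul_ι q hg hfg, qForm_sum_sum _ hf, qForm_sum_sum _ hf]
  have hq0 := q.2.1
  have hq1 := q.2.2
  have k : ∀ i, (starRingEnd ℂ (c i) * (c i * ((q : ℝ) : ℂ) ^ i) * (qFact q i : ℂ)).re
      = (q : ℝ) ^ i * (‖c i‖ ^ 2 * qFact q i) := by
    intro i
    have : starRingEnd ℂ (c i) * (c i * ((q : ℝ) : ℂ) ^ i) * (qFact q i : ℂ)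
        = (((q : ℝ) ^ i * (‖c i‖ ^ 2 * qFact q i) : ℝ) : ℂ) := by
      push_cast
      rw [← Complex.conj_mul']
      ring
    rw [this, Complex.ofReal_re]
  have k' : ∀ i, (starRingEnd ℂ (c i) * c i * (qFact q i : ℂ)).re = ‖c i‖ ^ 2 * qFact q i := by
    intro i
    rw [Complex.conj_mul', ← Complex.ofReal_pow, ← Complex.ofReal_mul, Complex.ofReal_re]
  have k'' : (RCLike.re (∑ i ∈ Finset.range N, starRingEnd ℂ (c i) * c i * (qFact q i : ℂ)) : ℝ)
      = ∑ i ∈ Finset.range N, ‖c i‖ ^ 2 * qFact q i := by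
    refine (Complex.re_sum _ _).trans ?_
    exact Finset.sum_congr rfl fun i _ => k' i
  rw [k'', Complex.re_sum, Finset.sum_congr rfl fun i _ => k i]
  obtain ⟨M, rfl⟩ := Nat.exists_eq_add_of_le' hN
  -- The terms `i = 0` and `i = 1` are split off both sums.
  rw [Finset.sum_range_succ', Finset.sum_range_succ', Finset.sum_range_succ' (n := M + 1),
    Finset.sum_range_succ' (n := M)]
  have hsum : ∑ i ∈ Finset.range M,
        (q : ℝ) ^ (i + 1 + 1) * (‖c (i + 1 + 1)‖ ^ 2 * qFact q (i + 1 + 1))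
      ≤ (q : ℝ) ^ 2 * ∑ i ∈ Finset.range M, ‖c (i + 1 + 1)‖ ^ 2 * qFact q (i + 1 + 1) := by
    rw [Finset.mul_sum]
    refine Finset.sum_le_sum fun i _ => mul_le_mul_of_nonneg_right ?_
      (mul_nonneg (sq_nonneg _) (qFact_nonneg q _))
    exact pow_le_pow_of_le_one hq0.le hq1.le (by omega)
  simp [qFact, qInt] at hsum ⊢
  nlinarith [hsum]

end PairOfGaussians

/-! ### The fourth moment of `γ(X(f)) + X(g)` -/

section FourthMoment

variable (q : Set.Ioo (0 : ℝ) 1) {H : Type*} [NormedAddCommGroup H] [InnerProductSpace ℂ H]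

theorem inner_creat_left (f : H) (x y : QFock q H) :
    inner ℂ (creat q f x) y = inner ℂ x (annih q f y) := by
  rw [← adjoint_annih, ContinuousLinearMap.adjoint_inner_left]

theorem inner_creat_right (f : H) (x y : QFock q H) :
    inner ℂ x (creat q f y) = inner ℂ (annih q f x) y := by
  rw [← adjoint_annih, ContinuousLinearMap.adjoint_inner_right]

theorem annih_creat (f g : H) (x : QFock q H) :
    annih q f (creat q g x) = (inner ℂ f g : ℂ) • x + ((q : ℝ) : ℂ) • creat q g (annih q f x) := by
  induction x using UniformSpace.Completion.induction_on with
  | hp =>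
    exact isClosed_eq (annih q f ∘L creat q g).continuous
      ((inner ℂ f g : ℂ) • ContinuousLinearMap.id ℂ (QFock q H)
        + ((q : ℝ) : ℂ) • (creat q g ∘L annih q f)).continuous
  | ih ξ =>
    have h : ∀ a : TensorAlgebra ℂ H, annih q f (creat q g (QFock.of q a))
        = (inner ℂ f g : ℂ) • QFock.of q a
          + ((q : ℝ) : ℂ) • creat q g (annih q f (QFock.of q a)) := by
      intro a
      rw [creat_of, annih_of, annih_of, creat_of, annihAlg_ι_mul, QFock.of_add, QFock.of_smul,
        QFock.of_smul]
    exact h ((toPreQFock q H).symm ξ)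

theorem annih_vacuum (f : H) : annih q f (vacuum q H) = 0 := by
  rw [vacuum, annih_of, annihAlg_one, QFock.of_zero]

theorem creat_vacuum (f : H) : creat q f (vacuum q H) = QFock.of q (ι ℂ f) := by
  rw [vacuum, creat_of, mul_one]

theorem norm_vacuum : ‖vacuum q H‖ = 1 := by
  rw [← sq_eq_sq₀ (norm_nonneg _) zero_le_one, ← inner_self_eq_norm_sq (𝕜 := ℂ), vacuum,
    QFock.inner_of, qForm_one]
  simp

theorem inner_vacuum_vacuum : inner ℂ (vacuum q H) (vacuum q H) = 1 := by
  rw [inner_self_eq_norm_sq_to_K, norm_vacuum]; simp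

theorem qGauss_vacuum (f : H) : qGauss q f (vacuum q H) = QFock.of q (ι ℂ f) := by
  rw [qGauss, add_apply, annih_vacuum, zero_add, creat_vacuum]

theorem qGauss_ι {f : H} (hf : ‖f‖ = 1) :
    qGauss q f (QFock.of q (ι ℂ f)) = vacuum q H + creat q f (creat q f (vacuum q H)) := by
  rw [qGauss, add_apply, ← creat_vacuum, annih_creat, annih_vacuum, map_zero, smul_zero, add_zero,
    inner_self_eq_norm_sq_to_K, hf]
  simp

/-- Since `X(f)Ω = f`, this is the fourth moment of a single `q`-Gaussian. -/
theorem norm_sq_qGauss_ι {f : H} (hf : ‖f‖ = 1) :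
    ‖qGauss q f (QFock.of q (ι ℂ f))‖ ^ 2 = 2 + (q : ℝ) := by
  have hff : inner ℂ f f = 1 := by simp [inner_self_eq_norm_sq_to_K, hf]
  have h1 : annih q f (creat q f (creat q f (vacuum q H)))
      = (1 + ((q : ℝ) : ℂ)) • creat q f (vacuum q H) := by
    rw [annih_creat, annih_creat, annih_vacuum, hff]
    simp [add_smul]
  have h2 : annih q f (creat q f (vacuum q H)) = vacuum q H := by
    rw [annih_creat, annih_vacuum, hff]
    simp
  have h3 : inner ℂ (vacuum q H + creat q f (creat q f (vacuum q H)))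
      (vacuum q H + creat q f (creat q f (vacuum q H))) = ((2 + q : ℝ) : ℂ) := by
    rw [inner_add_left, inner_add_right, inner_add_right, inner_creat_left, inner_creat_left,
      annih_vacuum, map_zero, inner_creat_right, annih_vacuum, inner_creat_left, h1,
      inner_smul_right, inner_creat_left, h2, inner_vacuum_vacuum]
    simp
    ring
  rw [qGauss_ι q hf, ← inner_self_eq_norm_sq (𝕜 := ℂ), h3]
  exact Complex.ofReal_re _

theorem IsSelfAdjoint.inner_apply_left {E : Type*} [NormedAddCommGroup E] [InnerProductSpace ℂ E]
    [CompleteSpace E] {T : E →L[ℂ] E} (hT : IsSelfAdjoint T) (x y : E) :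
    inner ℂ (T x) y = inner ℂ x (T y) := by
  rw [← ContinuousLinearMap.adjoint_inner_right]
  congr 2

theorem vacuumExp_pow_four {T : QFock q H →L[ℂ] QFock q H} (hT : IsSelfAdjoint T) :
    vacuumExp q (T ^ 4) = ((‖T (T (vacuum q H))‖ ^ 2 : ℝ) : ℂ) := by
  have : T ^ 4 = T * (T * (T * T)) := by simp only [pow_succ, pow_zero, one_mul, mul_assoc]
  rw [vacuumExp, this]
  simp only [mul_apply_eq_comp]
  rw [← hT.inner_apply_left, ← hT.inner_apply_left, inner_self_eq_norm_sq_to_K]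
  simp

/-- The number is the squared length of `(Y + X(g))² Ω`. That vector splits by the parity of the
number of letters `g`, and the two parts are orthogonal. -/
theorem vacuumExp_cfc_add_qGauss_pow_four {f g : H} (hf : ‖f‖ = 1) (hg : ‖g‖ = 1)
    (hfg : inner ℂ f g = 0) {γ : ℝ → ℝ} (hγ : Continuous γ) :
    vacuumExp q ((cfc γ (qGauss q f) + qGauss q g) ^ 4)
      = ((‖cfc γ (qGauss q f) (cfc γ (qGauss q f) (vacuum q H))‖ ^ 2
        + 4 * ‖cfc γ (qGauss q f) (vacuum q H)‖ ^ 2 + (2 + q)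
        + 2 * (inner ℂ (creat q g (cfc γ (qGauss q f) (vacuum q H)))
            (cfc γ (qGauss q f) (QFock.of q (ι ℂ g)))).re : ℝ) : ℂ) := by
  have hgg : inner ℂ g g = 1 := by simp [inner_self_eq_norm_sq_to_K, hg]
  set Y := cfc γ (qGauss q f) with hYdef
  have hY : IsSelfAdjoint Y := cfc_predicate γ (qGauss q f)
  have h2 : ∀ x, Y (Y x) = cfc (fun t => γ t * γ t) (qGauss q f) x := fun x => by
    rw [cfc_mul γ γ (qGauss q f) hγ.continuousOn hγ.continuousOn, mul_apply_eq_comp]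
  have h3 : ∀ x, Y (Y (Y x)) = cfc (fun t => γ t * (γ t * γ t)) (qGauss q f) x := fun x => by
    rw [cfc_mul γ (fun t => γ t * γ t) (qGauss q f) hγ.continuousOn (hγ.mul hγ).continuousOn,
      mul_apply_eq_comp, ← h2 x]
  have z1 : annih q g (Y (vacuum q H)) = 0 := annih_cfc_vacuum q hf hfg hγ
  have z2 : annih q g (Y (Y (vacuum q H))) = 0 := by
    rw [h2]; exact annih_cfc_vacuum q hf hfg (hγ.mul hγ)
  have z3 : annih q g (Y (Y (Y (vacuum q H)))) = 0 := by
    rw [h3]; exact annih_cfc_vacuum q hf hfg (hγ.mul (hγ.mul hγ))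
  have z4 : annih q g (annih q g (Y (QFock.of q (ι ℂ g)))) = 0 :=
    annih_annih_cfc q hf hg hfg hγ
  have n1 : ‖Y (QFock.of q (ι ℂ g))‖ = ‖Y (vacuum q H)‖ := norm_cfc_apply_ι q hf hg hfg hγ
  have n2 : ‖creat q g (Y (vacuum q H))‖ ^ 2 = ‖Y (vacuum q H)‖ ^ 2 := by
    rw [← inner_self_eq_norm_sq (𝕜 := ℂ), inner_creat_left, annih_creat, z1, hgg, map_zero,
      smul_zero, add_zero, one_smul, inner_self_eq_norm_sq]
  rw [vacuumExp_pow_four q (hY.add (isSelfAdjoint_qGauss q g))]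
  congr 1
  -- The first bracket is even in `g`, the second odd.
  have e : (Y + qGauss q g) ((Y + qGauss q g) (vacuum q H))
      = (Y (Y (vacuum q H)) + qGauss q g (QFock.of q (ι ℂ g)))
        + (Y (QFock.of q (ι ℂ g)) + creat q g (Y (vacuum q H))) := by
    rw [add_apply, add_apply, qGauss_vacuum, map_add, map_add,
      show qGauss q g (Y (vacuum q H)) = creat q g (Y (vacuum q H)) by
        rw [qGauss, add_apply, z1, zero_add]]
    abel
  have o : inner ℂ (Y (Y (vacuum q H)) + qGauss q g (QFock.of q (ι ℂ g)))
        (Y (QFock.of q (ι ℂ g)) + creat q g (Y (vacuum q H))) = 0 := by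
    have o1 : inner ℂ (Y (Y (vacuum q H))) (Y (QFock.of q (ι ℂ g))) = 0 := by
      rw [← hY.inner_apply_left, ← creat_vacuum, inner_creat_right, z3, inner_zero_left]
    have o2 : inner ℂ (Y (Y (vacuum q H))) (creat q g (Y (vacuum q H))) = 0 := by
      rw [inner_creat_right, z2, inner_zero_left]
    have o3 : inner ℂ (vacuum q H) (Y (QFock.of q (ι ℂ g))) = 0 := by
      rw [← hY.inner_apply_left, ← creat_vacuum, inner_creat_right, z1, inner_zero_left]
    have o4 : inner ℂ (creat q g (creat q g (vacuum q H))) (Y (QFock.of q (ι ℂ g))) = 0 := by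
      rw [inner_creat_left, inner_creat_left, z4, inner_zero_right]
    have o5 : inner ℂ (vacuum q H) (creat q g (Y (vacuum q H))) = 0 := by
      rw [inner_creat_right, annih_vacuum, inner_zero_left]
    have o6 : inner ℂ (creat q g (creat q g (vacuum q H))) (creat q g (Y (vacuum q H))) = 0 := by
      rw [inner_creat_left, annih_creat, z1, map_zero, smul_zero, add_zero, inner_smul_right,
        inner_creat_left, z1, inner_zero_right, mul_zero]
    rw [qGauss_ι q hg, inner_add_left, inner_add_right, inner_add_left, inner_add_right,
      inner_add_right, o1, o2, o3, o4, o5, o6]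
    simp
  have c1 : inner ℂ (Y (Y (vacuum q H))) (qGauss q g (QFock.of q (ι ℂ g)))
      = ((‖Y (vacuum q H)‖ ^ 2 : ℝ) : ℂ) := by
    rw [qGauss_ι q hg, inner_add_right, inner_creat_right, z2, inner_zero_left, add_zero,
      hY.inner_apply_left, inner_self_eq_norm_sq_to_K]
    simp
  -- The coefficient 4 of `‖YΩ‖²` collects 2 from the even cross term `c1` and 1 each from `n1` and
  -- `n2`.
  rw [e, @norm_add_sq ℂ, o, @norm_add_sq ℂ, @norm_add_sq ℂ, c1, norm_sq_qGauss_ι q hg, n1, n2,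
    inner_re_symm]
  simp only [map_zero, mul_zero, add_zero]
  have t1 : (RCLike.re ((‖Y (vacuum q H)‖ ^ 2 : ℝ) : ℂ) : ℝ) = ‖Y (vacuum q H)‖ ^ 2 :=
    Complex.ofReal_re _
  rw [t1]
  simp only [RCLike.re_eq_complex_re]
  ring

end FourthMoment

/-- The monic continuous `q`-Hermite polynomials, as functions. -/
def qHermite (q : ℝ) : ℕ → ℝ → ℝ
  | 0, _ => 1
  | 1, x => x
  | n + 2, x => x * qHermite q (n + 1) x - qInt q (n + 1) * qHermite q n x

theorem continuous_qHermite (q : ℝ) : ∀ n, Continuous (qHermite q n)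
  | 0 => by simpa [qHermite] using! (continuous_const : Continuous fun _ : ℝ => (1 : ℝ))
  | 1 => by simpa [qHermite] using! (continuous_id : Continuous fun x : ℝ => x)
  | n + 2 => by
    have h1 := continuous_qHermite q (n + 1)
    have h2 := continuous_qHermite q n
    change Continuous fun x => x * qHermite q (n + 1) x - qInt q (n + 1) * qHermite q n x
    fun_prop

/-! ### Growth of the `q`-Hermite polynomials from their three-term recurrence -/

section Recurrence

open Filter Topology

variable {q : ℝ}

theorem qInt_succ_sub (q : ℝ) (n : ℕ) : qInt q (n + 1) - qInt q n = q ^ n := by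
  induction n with
  | zero => simp [qInt]
  | succ n ih => rw [pow_succ', ← ih]; simp only [qInt]; ring

theorem qInt_mul (q : ℝ) (n : ℕ) : qInt q n * (1 - q) = 1 - q ^ n := by
  induction n with
  | zero => simp [qInt]
  | succ n ih => rw [pow_succ']; simp only [qInt]; linear_combination q * ih

theorem one_le_qInt_succ (h0 : 0 < q) (n : ℕ) : 1 ≤ qInt q (n + 1) := by
  induction n with
  | zero => simp [qInt]
  | succ n ih => rw [qInt]; nlinarith

theorem qInt_le (h0 : 0 < q) (h1 : q < 1) (n : ℕ) : qInt q n ≤ 1 / (1 - q) := by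
  rw [le_div_iff₀ (sub_pos.mpr h1), qInt_mul]
  have := pow_pos h0 n
  linarith

theorem qFact_pos (h0 : 0 < q) (n : ℕ) : 0 < qFact q n := by
  induction n with
  | zero => exact one_pos
  | succ n ih => exact mul_pos (one_pos.trans_le (one_le_qInt_succ h0 n)) ih

/-- The square of the `n`-th orthonormal `q`-Hermite polynomial. -/
def hermSq (q x : ℝ) (n : ℕ) : ℝ := qHermite q n x ^ 2 / qFact q n

/-- A quadratic form in two consecutive orthonormal polynomials that is nondecreasing in `n`. -/
def turan (q x : ℝ) (n : ℕ) : ℝ :=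
  (qHermite q (n + 1) x ^ 2 + qInt q (n + 1) * qHermite q n x ^ 2
    - x * qHermite q n x * qHermite q (n + 1) x) / qFact q n

/-- The squared norm of the Christoffel–Darboux numerator. -/
def darbouxSq (q x : ℝ) (n : ℕ) : ℝ :=
  (qHermite q (n + 1) x ^ 2 + qInt q (n + 1) * qHermite q n x ^ 2) / qFact q n

theorem hermSq_nonneg (h0 : 0 < q) (x : ℝ) (n : ℕ) : 0 ≤ hermSq q x n :=
  div_nonneg (sq_nonneg _) (qFact_pos h0 n).le

theorem turan_zero (q x : ℝ) : turan q x 0 = 1 := by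
  simp [turan, qHermite, qInt, qFact]; ring

/-- With a constant recurrence coefficient the form would be invariant; the increment is the jump
`[n+2]_q - [n+1]_q = q^(n+1)` of the coefficient. -/
theorem turan_succ (h0 : 0 < q) (x : ℝ) (n : ℕ) :
    turan q x (n + 1) = turan q x n + q ^ (n + 1) * hermSq q x (n + 1) := by
  have hw := (qFact_pos h0 n).ne'
  have hb := (one_pos.trans_le (one_le_qInt_succ h0 n)).ne'
  rw [← qInt_succ_sub]
  simp only [turan, hermSq]
  rw [show qFact q (n + 1) = qInt q (n + 1) * qFact q n from rfl,
    show qHermite q (n + 1 + 1) x = x * qHermite q (n + 1) x - qInt q (n + 1) * qHermite q n x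
      from rfl]
  field_simp
  ring

theorem one_le_turan (h0 : 0 < q) (x : ℝ) (n : ℕ) : 1 ≤ turan q x n := by
  induction n with
  | zero => exact (turan_zero q x).ge
  | succ n ih =>
    rw [turan_succ h0]
    have := mul_nonneg (pow_pos h0 (n + 1)).le (hermSq_nonneg h0 x (n + 1))
    linarith

theorem darbouxSq_eq (h0 : 0 < q) (x : ℝ) (n : ℕ) :
    darbouxSq q x n = qInt q (n + 1) * (hermSq q x (n + 1) + hermSq q x n) := by
  have hw := (qFact_pos h0 n).ne'
  have hb := (one_pos.trans_le (one_le_qInt_succ h0 n)).ne'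
  simp only [darbouxSq, hermSq]
  rw [show qFact q (n + 1) = qInt q (n + 1) * qFact q n from rfl]
  field_simp

theorem turan_le (h0 : 0 < q) (x : ℝ) (n : ℕ) :
    turan q x n ≤ (1 + |x|) * darbouxSq q x n := by
  have hw := qFact_pos h0 n
  rw [turan, darbouxSq, ← mul_div_assoc]
  refine div_le_div_of_nonneg_right ?_ hw.le
  set a := qHermite q n x
  set c := qHermite q (n + 1) x
  have hb := one_le_qInt_succ h0 n
  have h1 : -(x * a * c) ≤ |x| * (|a| * |c|) := by
    rw [← abs_mul, ← abs_mul, ← mul_assoc]; exact neg_le_abs _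
  have h2 : |a| * |c| ≤ c ^ 2 + qInt q (n + 1) * a ^ 2 := by
    rw [← sq_abs a, ← sq_abs c]
    nlinarith [sq_nonneg (|a| - |c|), sq_nonneg (|a|), sq_nonneg (|c|)]
  nlinarith [mul_le_mul_of_nonneg_left h2 (abs_nonneg x)]

/-- The form `turan` stays at least 1, while it is at most `(1 + |x|) / (1 - q)` times the sum of
two consecutive terms. So consecutive pairs are bounded below by a constant. -/
theorem hermSq_sum_unbounded (h0 : 0 < q) (h1 : q < 1) (x M : ℝ) :
    ∃ N, M < ∑ n ∈ Finset.range N, hermSq q x n := by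
  set c := (1 - q) / (1 + |x|) with hc
  have hx : 0 < 1 + |x| := by positivity
  have hcpos : 0 < c := div_pos (sub_pos.mpr h1) hx
  have key : ∀ n, c ≤ hermSq q x n + hermSq q x (n + 1) := by
    intro n
    have e1 := (one_le_turan h0 x n).trans (turan_le h0 x n)
    rw [darbouxSq_eq h0] at e1
    have e2 := qInt_le h0 h1 (n + 1)
    have e3 := hermSq_nonneg h0 x n
    have e4 := hermSq_nonneg h0 x (n + 1)
    have e5 : qInt q (n + 1) * (hermSq q x (n + 1) + hermSq q x n)
        ≤ 1 / (1 - q) * (hermSq q x (n + 1) + hermSq q x n) :=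
      mul_le_mul_of_nonneg_right e2 (by positivity)
    have e6 := e1.trans (mul_le_mul_of_nonneg_left e5 hx.le)
    rw [hc, div_le_iff₀ hx]
    have h1' := sub_pos.mpr h1
    have e7 : (1 - q) * 1 ≤ (1 - q) * ((1 + |x|) * (1 / (1 - q)
        * (hermSq q x (n + 1) + hermSq q x n))) := mul_le_mul_of_nonneg_left e6 h1'.le
    have e8 : (1 - q) * ((1 + |x|) * (1 / (1 - q) * (hermSq q x (n + 1) + hermSq q x n)))
        = (hermSq q x n + hermSq q x (n + 1)) * (1 + |x|) := by
      field_simp; ring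
    linarith
  have lower : ∀ N : ℕ, N * c ≤ ∑ n ∈ Finset.range (2 * N), hermSq q x n := by
    intro N
    induction N with
    | zero => simp
    | succ N ih =>
      rw [show 2 * (N + 1) = 2 * N + 1 + 1 by ring, Finset.sum_range_succ, Finset.sum_range_succ]
      have := key (2 * N)
      push_cast
      linarith
  obtain ⟨N, hN⟩ := exists_nat_gt (M / c)
  refine ⟨2 * N, lt_of_lt_of_le ?_ (lower N)⟩
  rwa [div_lt_iff₀ hcpos] at hN

/-- Strictly inside the support the form `turan` is eventually uniformly positive definite, hence
comparable to `darbouxSq`. Its relative increments are then `O(q^n)` and summable, so it stays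
bounded. -/
theorem darbouxSq_bounded (h0 : 0 < q) (h1 : q < 1) {x : ℝ} (hx : x ^ 2 < 4 / (1 - q)) :
    ∃ C, ∃ n₀, ∀ n ≥ n₀, darbouxSq q x n ≤ C := by
  have h1' := sub_pos.mpr h1
  -- The gap `1 - t` is the ellipticity constant; it exists because the bound on `x` is strict.
  obtain ⟨t, ht, ht1⟩ : ∃ t, x ^ 2 < t ^ 2 * (4 / (1 - q)) ∧ 0 < t ∧ t < 1 := by
    have hc : Tendsto (fun t : ℝ => t ^ 2 * (4 / (1 - q))) (𝓝[<] 1) (𝓝 (1 ^ 2 * (4 / (1 - q)))) :=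
      tendsto_nhdsWithin_of_tendsto_nhds (Continuous.tendsto (by fun_prop) 1)
    have e1 := hc.eventually_const_lt (show x ^ 2 < 1 ^ 2 * (4 / (1 - q)) by simpa using hx)
    have e2 : ∀ᶠ t : ℝ in 𝓝[<] 1, t ∈ Set.Ioo (0 : ℝ) 1 := Ioo_mem_nhdsLT one_pos
    obtain ⟨t, h, h'⟩ := (e1.and e2).exists
    exact ⟨t, h, h'⟩
  have hlim : Tendsto (fun n : ℕ => t ^ 2 * (4 * qInt q (n + 1))) atTop
      (𝓝 (t ^ 2 * (4 / (1 - q)))) := by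
    have hq : Tendsto (fun n : ℕ => q ^ (n + 1)) atTop (𝓝 0) :=
      (tendsto_pow_atTop_nhds_zero_of_lt_one h0.le h1).comp (tendsto_add_atTop_nat 1)
    have e : (fun n : ℕ => t ^ 2 * (4 * qInt q (n + 1)))
        = fun n : ℕ => t ^ 2 * (4 * ((1 - q ^ (n + 1)) / (1 - q))) := by
      ext n; rw [← qInt_mul, mul_div_cancel_right₀ _ h1'.ne']
    rw [e, show t ^ 2 * (4 / (1 - q)) = t ^ 2 * (4 * ((1 - 0) / (1 - q))) by ring]
    exact ((((hq.const_sub 1).div_const _).const_mul 4).const_mul _)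
  obtain ⟨n₀, hn₀⟩ := eventually_atTop.mp (hlim.eventually_const_lt ht)
  have hlow : ∀ n ≥ n₀, darbouxSq q x n ≤ 1 / (1 - t) * turan q x n := by
    intro n hn
    have hw := qFact_pos h0 n
    have hb := one_le_qInt_succ h0 n
    have hxb := hn₀ n hn
    rw [turan, darbouxSq, ← mul_div_assoc]
    refine div_le_div_of_nonneg_right ?_ hw.le
    set a := qHermite q n x
    set c := qHermite q (n + 1) x
    set b := qInt q (n + 1)
    -- From `x² < 4 t² b` and the arithmetic–geometric inequality `4 b a² c² ≤ (c² + b a²)²`.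
    have h2 : x * a * c ≤ t * (c ^ 2 + b * a ^ 2) := by
      refine abs_le_of_sq_le_sq' ?_ (by have := ht1.1; positivity) |>.2
      have h3 : x ^ 2 * (a * c) ^ 2 ≤ t ^ 2 * (4 * b) * (a * c) ^ 2 :=
        mul_le_mul_of_nonneg_right hxb.le (sq_nonneg _)
      nlinarith [mul_nonneg (sq_nonneg t) (sq_nonneg (c ^ 2 - b * a ^ 2))]
    rw [div_mul_eq_mul_div, one_mul, le_div_iff₀ (by linarith [ht1.2])]
    linarith
  set C := 1 / (1 - t) with hC
  have hCpos : 0 < C := div_pos one_pos (by linarith [ht1.2])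
  -- The exponent sums the powers `q^(n+1)` in telescoped form, as a difference of `q`-integers.
  have hgrow : ∀ k, turan q x (n₀ + k)
      ≤ turan q x n₀ * Real.exp (C * (qInt q (n₀ + k + 1) - qInt q (n₀ + 1))) := by
    intro k
    induction k with
    | zero => simp
    | succ k ih =>
      have e1 := hlow (n₀ + k) (by omega)
      rw [darbouxSq_eq h0] at e1
      have hb := one_le_qInt_succ h0 (n₀ + k)
      have e3 := hermSq_nonneg h0 x (n₀ + k)
      have e4 := hermSq_nonneg h0 x (n₀ + k + 1)
      have e5 : hermSq q x (n₀ + k + 1) ≤ C * turan q x (n₀ + k) := by nlinarith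
      have hp := pow_pos h0 (n₀ + k + 1)
      have ht0 : 0 < turan q x (n₀ + k) := one_pos.trans_le (one_le_turan h0 x _)
      have e6 : turan q x (n₀ + k + 1)
          ≤ turan q x (n₀ + k) * Real.exp (C * q ^ (n₀ + k + 1)) := by
        rw [turan_succ h0]
        have := Real.add_one_le_exp (C * q ^ (n₀ + k + 1))
        nlinarith [mul_le_mul_of_nonneg_left e5 hp.le, mul_le_mul_of_nonneg_left this ht0.le]
      have e7 := e6.trans (mul_le_mul_of_nonneg_right ih (Real.exp_pos _).le)
      rw [mul_assoc, ← Real.exp_add, ← mul_add] at e7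
      refine e7.trans (le_of_eq ?_)
      rw [← qInt_succ_sub q (n₀ + k + 1)]
      congr 3
      rw [← add_assoc]
      ring
  refine ⟨C * (turan q x n₀ * Real.exp (C * (1 / (1 - q)))), n₀, fun n hn => ?_⟩
  obtain ⟨k, rfl⟩ := Nat.exists_eq_add_of_le hn
  refine (hlow _ hn).trans (mul_le_mul_of_nonneg_left ((hgrow k).trans ?_) hCpos.le)
  refine mul_le_mul_of_nonneg_left (Real.exp_le_exp.mpr ?_)
    (zero_le_one.trans (one_le_turan h0 x n₀))
  refine mul_le_mul_of_nonneg_left ?_ hCpos.le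
  have := qInt_le h0 h1 (n₀ + k + 1)
  have := one_le_qInt_succ h0 n₀
  linarith

theorem christoffel_darboux (h0 : 0 < q) (x y : ℝ) (N : ℕ) :
    (y - x) * ∑ n ∈ Finset.range (N + 1), qHermite q n x / qFact q n * qHermite q n y
      = qHermite q N x / qFact q N * qHermite q (N + 1) y
        - qHermite q (N + 1) x / qFact q N * qHermite q N y := by
  induction N with
  | zero => simp [qHermite, qFact]
  | succ N ih =>
    rw [Finset.sum_range_succ, mul_add, ih]
    have hw := (qFact_pos h0 N).ne'
    have hb := (one_pos.trans_le (one_le_qInt_succ h0 N)).ne'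
    rw [show qFact q (N + 1) = qInt q (N + 1) * qFact q N from rfl]
    simp only [qHermite]
    field_simp
    ring

end Recurrence

/-! ### Atoms and support of a measure orthogonalising the `q`-Hermite polynomials -/

section OrthogonalityMeasure

open MeasureTheory

variable {q : ℝ} {μ : Measure ℝ}

theorem integral_sum_qHermite_sq
    (hi : ∀ g : ℝ → ℝ, Continuous g → Integrable g μ)
    (ho : ∀ m n, ∫ y, qHermite q m y * qHermite q n y ∂μ = if m = n then qFact q n else 0)
    (N : ℕ) (c : ℕ → ℝ) :
    ∫ y, (∑ n ∈ Finset.range N, c n * qHermite q n y) ^ 2 ∂μ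
      = ∑ n ∈ Finset.range N, c n ^ 2 * qFact q n := by
  have hc := continuous_qHermite q
  have e : ∀ y, (∑ n ∈ Finset.range N, c n * qHermite q n y) ^ 2
      = ∑ m ∈ Finset.range N, ∑ n ∈ Finset.range N,
          c m * c n * (qHermite q m y * qHermite q n y) := by
    intro y
    rw [sq, Finset.sum_mul_sum]
    exact Finset.sum_congr rfl fun m _ => Finset.sum_congr rfl fun n _ => by ring
  simp_rw [e]
  rw [integral_finsetSum _ fun m _ => hi _ (by fun_prop)]
  refine Finset.sum_congr rfl fun m hm => ?_
  rw [integral_finsetSum _ fun n _ => hi _ (by fun_prop), Finset.sum_eq_single m]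
  · rw [integral_const_mul, ho, if_pos rfl]; ring
  · intro n _ hn
    rw [integral_const_mul, ho, if_neg hn.symm, mul_zero]
  · exact fun h => absurd hm h

theorem integral_kernel_sq (h0 : 0 < q)
    (hi : ∀ g : ℝ → ℝ, Continuous g → Integrable g μ)
    (ho : ∀ m n, ∫ y, qHermite q m y * qHermite q n y ∂μ = if m = n then qFact q n else 0)
    (x : ℝ) (N : ℕ) :
    ∫ y, (∑ n ∈ Finset.range N, qHermite q n x / qFact q n * qHermite q n y) ^ 2 ∂μ
      = ∑ n ∈ Finset.range N, hermSq q x n := by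
  rw [integral_sum_qHermite_sq hi ho]
  refine Finset.sum_congr rfl fun n _ => ?_
  have := (qFact_pos h0 n).ne'
  rw [hermSq]
  field_simp

/-- The reproducing kernel `K` at `x` satisfies `K(x)² μ{x} ≤ ∫ K² dμ = K(x)`, so `μ{x} ≤ 1 / K(x)`,
and `K(x)` is unbounded in the degree. -/
theorem noAtoms_of_orthogonal (h0 : 0 < q) (h1 : q < 1) [IsFiniteMeasure μ]
    (hi : ∀ g : ℝ → ℝ, Continuous g → Integrable g μ)
    (ho : ∀ m n, ∫ y, qHermite q m y * qHermite q n y ∂μ = if m = n then qFact q n else 0) :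
    NullSingletonClass μ := by
  refine ⟨fun x => ?_⟩
  by_contra hne
  have hm : 0 < μ.real {x} := ENNReal.toReal_pos hne (measure_ne_top _ _)
  obtain ⟨N, hN⟩ := hermSq_sum_unbounded h0 h1 x (1 / μ.real {x})
  have hc := continuous_qHermite q
  set K : ℝ → ℝ := fun y => ∑ n ∈ Finset.range N, qHermite q n x / qFact q n * qHermite q n y
    with hK
  have hKx : K x = ∑ n ∈ Finset.range N, hermSq q x n :=
    Finset.sum_congr rfl fun n _ => by rw [hermSq]; ring
  have hle : ∫ y in {x}, K y ^ 2 ∂μ ≤ ∫ y, K y ^ 2 ∂μ :=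
    setIntegral_le_integral (hi _ (by fun_prop)) (Filter.Eventually.of_forall fun y => sq_nonneg _)
  rw [integral_kernel_sq h0 hi ho, integral_singleton, hKx, smul_eq_mul] at hle
  set S := ∑ n ∈ Finset.range N, hermSq q x n
  have hS : 0 < S := (one_div_pos.mpr hm).trans hN
  rw [div_lt_iff₀ hm] at hN
  nlinarith

/-- On a null interval around `x` one would have `δ² ∫ K² ≤ ∫ (y - x)² K²`. The left side diverges
with the degree, and by Christoffel–Darboux the right side equals the bounded quantity `darbouxSq`.
-/
theorem measure_Ioo_ne_zero_of_orthogonal (h0 : 0 < q) (h1 : q < 1)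
    (hi : ∀ g : ℝ → ℝ, Continuous g → Integrable g μ)
    (ho : ∀ m n, ∫ y, qHermite q m y * qHermite q n y ∂μ = if m = n then qFact q n else 0)
    {x δ : ℝ} (hx : x ^ 2 < 4 / (1 - q)) (hδ : 0 < δ) :
    μ (Set.Ioo (x - δ) (x + δ)) ≠ 0 := by
  intro hz
  have hc := continuous_qHermite q
  obtain ⟨C, n₀, hC⟩ := darbouxSq_bounded h0 h1 hx
  have key : ∀ N, δ ^ 2 * ∑ n ∈ Finset.range (N + 1), hermSq q x n ≤ darbouxSq q x N := by
    intro N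
    rw [← integral_kernel_sq h0 hi ho, ← integral_const_mul]
    set K : ℝ → ℝ :=
      fun y => ∑ n ∈ Finset.range (N + 1), qHermite q n x / qFact q n * qHermite q n y with hK
    have e1 : ∫ y, δ ^ 2 * K y ^ 2 ∂μ ≤ ∫ y, ((y - x) * K y) ^ 2 ∂μ := by
      refine integral_mono_ae (hi _ (by fun_prop)) (hi _ (by fun_prop)) ?_
      have hae : ∀ᵐ y ∂μ, y ∉ Set.Ioo (x - δ) (x + δ) := measure_eq_zero_iff_ae_notMem.mp hz
      filter_upwards [hae] with y hy
      have : δ ≤ |y - x| := by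
        by_contra hlt
        rw [not_le, abs_lt] at hlt
        exact hy ⟨by linarith, by linarith⟩
      change δ ^ 2 * K y ^ 2 ≤ ((y - x) * K y) ^ 2
      rw [mul_pow, ← sq_abs (y - x)]
      gcongr
    refine e1.trans (le_of_eq ?_)
    -- Only degrees `N` and `N + 1` survive; the middle term integrates to 0 by orthogonality.
    have e2 : ∀ y, ((y - x) * K y) ^ 2 =
        (qHermite q N x / qFact q N) ^ 2 * (qHermite q (N + 1) y * qHermite q (N + 1) y)
        + (-2 * (qHermite q N x / qFact q N) * (qHermite q (N + 1) x / qFact q N))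
            * (qHermite q (N + 1) y * qHermite q N y)
        + (qHermite q (N + 1) x / qFact q N) ^ 2 * (qHermite q N y * qHermite q N y) := by
      intro y
      rw [hK, christoffel_darboux h0]
      ring
    simp_rw [e2]
    rw [integral_add (hi _ (by fun_prop)) (hi _ (by fun_prop)),
      integral_add (hi _ (by fun_prop)) (hi _ (by fun_prop)), integral_const_mul,
      integral_const_mul, integral_const_mul, ho, ho, ho, if_pos rfl, if_pos rfl,
      if_neg (by omega), darbouxSq, show qFact q (N + 1) = qInt q (N + 1) * qFact q N from rfl]
    have := (qFact_pos h0 N).ne'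
    field_simp
    ring
  obtain ⟨N, hN⟩ := hermSq_sum_unbounded h0 h1 x (C / δ ^ 2)
  have e1 := (key (max N n₀)).trans (hC _ (le_max_right _ _))
  have e2 : ∑ n ∈ Finset.range N, hermSq q x n
      ≤ ∑ n ∈ Finset.range (max N n₀ + 1), hermSq q x n :=
    Finset.sum_le_sum_of_subset_of_nonneg (Finset.range_mono (by omega))
      fun n _ _ => hermSq_nonneg h0 x n
  have hd : 0 < δ ^ 2 := by positivity
  rw [div_lt_iff₀ hd] at hN
  nlinarith

end OrthogonalityMeasure

/-! ### A nontrivial continuous map preserving a measure on an interval -/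

section Transport

open MeasureTheory Set ProbabilityTheory

variable {μ : Measure ℝ}

theorem eqOn_Icc_of_ae_eq {a b : ℝ} (hab : a < b)
    (hpos : ∀ x ∈ Ioo a b, ∀ δ > 0, μ (Ioo (x - δ) (x + δ)) ≠ 0)
    {g k : ℝ → ℝ} (hg : Continuous g) (hk : Continuous k) (h : g =ᵐ[μ] k) :
    EqOn g k (Icc a b) := by
  have h1 : EqOn g k (Ioo a b) := by
    intro x hx
    by_contra hne
    obtain ⟨δ, hδ, hball⟩ := Metric.isOpen_iff.mp (isOpen_ne_fun hg hk) x hne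
    refine hpos x hx δ hδ (measure_mono_null ?_ h)
    rw [← Real.ball_eq_Ioo]
    exact hball
  have := h1.closure hg hk
  rwa [closure_Ioo hab.ne] at this

variable [IsProbabilityMeasure μ]

theorem continuous_cdf [NullSingletonClass μ] : Continuous (cdf μ) := by
  rw [continuous_iff_continuousAt]
  intro x
  rw [(monotone_cdf μ).continuousAt_iff_leftLim_eq_rightLim, StieltjesFunction.rightLim_eq]
  have h := (cdf μ).measure_singleton x
  rw [measure_cdf, measure_singleton, eq_comm, ENNReal.ofReal_eq_zero] at h
  exact le_antisymm ((monotone_cdf μ).leftLim_le le_rfl) (by linarith)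

theorem measureReal_Ioo_eq_cdf [NullSingletonClass μ] {u v : ℝ} (h : u ≤ v) :
    μ.real (Ioo u v) = cdf μ v - cdf μ u := by
  have e : μ.real (Ioo u v) = μ.real (Ioc u v) := measureReal_congr Ioo_ae_eq_Ioc
  rw [e, cdf_eq_real, cdf_eq_real, show Ioc u v = Iic v \ Iic u by ext; simp [and_comm],
    measureReal_sdiff (Iic_subset_Iic.mpr h) measurableSet_Iic]

/-- The distribution function carries `μ` to the uniform law on `[0, 1]`, which the tent map `u ↦ 1
- |2u - 1|` preserves; conjugating back gives `γ`. -/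
theorem exists_folding_map [NullSingletonClass μ] {r : ℝ} (hr : 0 < r)
    (hsupp : μ (Icc (-r) r)ᶜ = 0)
    (hpos : ∀ x ∈ Ioo (-r) r, ∀ δ > 0, μ (Ioo (x - δ) (x + δ)) ≠ 0) :
    ∃ γ : ℝ → ℝ, Continuous γ ∧ μ.map γ = μ ∧
      ¬ (γ =ᵐ[μ] fun x => x) ∧ ¬ (γ =ᵐ[μ] fun x => -x) := by
  have hc := continuous_cdf (μ := μ)
  have cm := monotone_cdf μ
  have c0 : cdf μ (-r) = 0 := by
    rw [cdf_eq_real, measureReal_congr (Iio_ae_eq_Iic (a := -r)).symm, measureReal_def,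
      measure_mono_null ?_ hsupp]
    · rfl
    · exact fun x hx h => absurd h.1 (not_le.mpr hx)
  have c1 : cdf μ r = 1 := by
    have h0 : μ.real (Iic r)ᶜ = 0 := by
      rw [measureReal_def, measure_mono_null ?_ hsupp]
      · rfl
      · exact compl_subset_compl.mpr fun x hx => hx.2
    rw [probReal_compl_eq_one_sub measurableSet_Iic, ← cdf_eq_real] at h0
    linarith
  -- Extending the distribution function with slope 1 outside `[-r, r]` makes it a homeomorphism of
  -- `ℝ`, so its inverse is globally defined and continuous.
  set F : ℝ → ℝ := fun x => cdf μ x + (x - max (-r) (min x r)) with hF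
  have hFc : Continuous F := by fun_prop
  have hmid : ∀ x ∈ Icc (-r) r, F x = cdf μ x := by
    intro x hx
    simp [hF, min_eq_left hx.2, max_eq_right hx.1]
  have hclamp : ∀ x, cdf μ x = max 0 (min (F x) 1) := by
    intro x
    have n0 := cdf_nonneg μ x
    have n1 := cdf_le_one μ x
    rcases le_total x (-r) with hx | hx
    · have hz : cdf μ x = 0 := le_antisymm (c0 ▸ cm hx) n0
      have : F x = x + r := by
        simp [hF, hz, min_eq_left (hx.trans (by linarith : -r ≤ r)), max_eq_left hx]
      rw [hz, this, max_eq_left]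
      exact (min_le_left _ _).trans (by linarith)
    rcases le_total x r with hx' | hx'
    · rw [hmid x ⟨hx, hx'⟩, min_eq_left n1, max_eq_right n0]
    · have hz : cdf μ x = 1 := le_antisymm n1 (c1 ▸ cm hx')
      have : F x = 1 + (x - r) := by
        simp [hF, hz, min_eq_right hx', max_eq_right (by linarith : -r ≤ r)]
      rw [hz, this, min_eq_right (by linarith), max_eq_right zero_le_one]
  have hFm : StrictMono F := by
    intro x y hxy
    have hm := cm hxy.le
    have clamp_le : max (-r) (min y r) - max (-r) (min x r) ≤ y - x := by
      grind
    rcases le_or_gt y (-r) with h1 | h1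
    · simp only [hF]
      rw [max_eq_left ((min_le_left _ _).trans h1),
        max_eq_left ((min_le_left _ _).trans (hxy.le.trans h1))]
      linarith
    rcases le_or_gt r x with h2 | h2
    · simp only [hF]
      rw [min_eq_right h2, min_eq_right (h2.trans hxy.le)]
      linarith
    · have hlt : max x (-r) < min y r := max_lt (lt_min hxy h2) (lt_min h1 (by linarith))
      set a := max x (-r)
      set b := min y r
      -- The interval `(a, b)` is `(x, y)` cut down to `(-r, r)`, written as centre and radius to
      -- fit `hpos`.
      have hp := hpos ((a + b) / 2) ⟨by linarith [le_max_right x (-r)],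
        by linarith [min_le_right y r]⟩ ((b - a) / 2) (by linarith)
      have : 0 < μ.real (Ioo x y) := by
        refine ENNReal.toReal_pos (fun h0 => hp (measure_mono_null ?_ h0)) (measure_ne_top _ _)
        refine Ioo_subset_Ioo ?_ ?_
        · linarith [le_max_left x (-r)]
        · linarith [min_le_left y r]
      rw [measureReal_Ioo_eq_cdf hxy.le] at this
      simp only [hF]
      linarith
  have hFs : Function.Surjective F := by
    refine hFc.surjective ?_ ?_
    · refine Filter.tendsto_atTop_mono (f := fun x => x - r) (fun x => ?_)
        (Filter.tendsto_atTop_add_const_right _ _ Filter.tendsto_id)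
      have := cdf_nonneg μ x
      have : max (-r) (min x r) ≤ r := max_le (by linarith) (min_le_right _ _)
      simp only [hF]
      linarith
    · refine Filter.tendsto_atBot_mono (fun x => (?_ : F x ≤ x + (1 + r)))
        (Filter.tendsto_atBot_add_const_right _ _ Filter.tendsto_id)
      have := cdf_le_one μ x
      have : -r ≤ max (-r) (min x r) := le_max_left _ _
      simp only [hF]
      linarith
  let e : ℝ ≃o ℝ := hFm.orderIsoOfSurjective F hFs
  have he : ∀ x, e x = F x := fun x => rfl
  have hes : ∀ y, F (e.symm y) = y := fun y => e.apply_symm_apply y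
  have hsF : ∀ x, e.symm (F x) = x := fun x => e.symm_apply_apply x
  set γ : ℝ → ℝ := fun x => e.symm (1 - |2 * F x - 1|) with hγ
  have hγc : Continuous γ := e.symm.continuous.comp (by fun_prop)
  have hend : F (-r) = 0 := by rw [hmid _ ⟨le_rfl, by linarith⟩, c0]
  have hend' : F r = 1 := by rw [hmid _ ⟨by linarith, le_rfl⟩, c1]
  have g0 : γ (-r) = -r := by
    simp only [hγ, hend]
    norm_num
    rw [← hend, hsF]
  have g1 : γ r = -r := by
    simp only [hγ, hend']
    norm_num
    rw [← hend, hsF]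
  refine ⟨γ, hγc, ?_, fun h => ?_, fun h => ?_⟩
  · have : IsProbabilityMeasure (μ.map γ) := Measure.isProbabilityMeasure_map hγc.aemeasurable
    refine Measure.ext_of_Iic _ _ fun t => ?_
    rw [Measure.map_apply hγc.measurable measurableSet_Iic]
    -- The two branches of the tent: `1 - |2u - 1| ≤ s` exactly when `u ≤ s/2` or `u ≥ 1 - s/2`. For
    -- `t` in `[-r, r]` the removed interval has mass `1 - F t`.
    have hpre : γ ⁻¹' Iic t = (Ioo (e.symm (F t / 2)) (e.symm (1 - F t / 2)))ᶜ := by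
      ext x
      rw [mem_preimage, mem_Iic, mem_compl_iff, mem_Ioo, OrderIso.symm_apply_lt,
        OrderIso.lt_symm_apply, he]
      simp only [hγ]
      rw [OrderIso.symm_apply_le, he, not_and_or, not_lt, not_lt, sub_le_comm, le_abs]
      constructor
      · rintro (h | h)
        · right; linarith
        · left; linarith
      · rintro (h | h)
        · right; linarith
        · left; linarith
    rw [← ENNReal.toReal_eq_toReal_iff' (measure_ne_top _ _) (measure_ne_top _ _)]
    change μ.real _ = μ.real _
    rw [hpre, probReal_compl_eq_one_sub measurableSet_Ioo, ← cdf_eq_real, hclamp t]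
    rcases le_or_gt (F t) 1 with h1 | h1
    · rw [measureReal_Ioo_eq_cdf (e.symm.monotone (by linarith)), hclamp, hclamp (e.symm _), hes,
        hes, min_eq_left h1, min_eq_left (by linarith : F t / 2 ≤ 1)]
      rcases le_total 0 (F t) with h0 | h0
      · rw [min_eq_left (by linarith), max_eq_right h0, max_eq_right (by linarith),
          max_eq_right (by linarith)]
        ring
      · rw [min_eq_right (by linarith), max_eq_left h0, max_eq_right zero_le_one,
          max_eq_left (by linarith)]
        ring
    · rw [Ioo_eq_empty_of_le (e.symm.monotone (by linarith)), min_eq_right h1.le]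
      simp
  -- Both endpoints go to `-r`: the right one excludes the identity, the left one excludes the
  -- reflection.
  · have := eqOn_Icc_of_ae_eq (by linarith) hpos hγc continuous_id h
      (show r ∈ Icc (-r) r from ⟨by linarith, le_rfl⟩)
    rw [g1] at this
    simp at this
    linarith
  · have := eqOn_Icc_of_ae_eq (by linarith) hpos hγc continuous_neg h
      (show -r ∈ Icc (-r) r from ⟨le_rfl, by linarith⟩)
    rw [g0] at this
    simp at this
    linarith

end Transport

/-! ### The law of a `q`-Gaussian and the strict inequality -/

section GaussianLaw

open MeasureTheory Set

/-- The inner product is real because the two self-adjoint operators commute. -/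
theorem inner_cfc_cfc {E : Type*} [NormedAddCommGroup E] [InnerProductSpace ℂ E]
    [CompleteSpace E] (v : E) (T : E →L[ℂ] E) {g k : ℝ → ℝ}
    (hg : Continuous g) (hk : Continuous k) :
    inner ℂ (cfc g T v) (cfc k T v) = ((∫ x, g x * k x ∂(distIn v T) : ℝ) : ℂ) := by
  have hgs : IsSelfAdjoint (cfc g T) := cfc_predicate g T
  have hks : IsSelfAdjoint (cfc k T) := cfc_predicate k T
  refine Complex.ext (by simp [integral_mul_distIn v hg hk]) ?_
  rw [Complex.ofReal_im, ← Complex.conj_eq_iff_im, inner_conj_symm, hks.inner_apply_left,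
    hgs.inner_apply_left, ← mul_apply_eq_comp, ← mul_apply_eq_comp, (cfc_commute_cfc k g T).eq]

theorem norm_sq_cfc_apply {E : Type*} [NormedAddCommGroup E] [InnerProductSpace ℂ E]
    [CompleteSpace E] (v : E) (T : E →L[ℂ] E) {g : ℝ → ℝ} (hg : Continuous g) :
    ‖cfc g T v‖ ^ 2 = ∫ x, g x * g x ∂(distIn v T) := by
  rw [integral_mul_distIn v hg hg]
  exact (inner_self_eq_norm_sq (𝕜 := ℂ) _).symm

variable (q : Set.Ioo (0 : ℝ) 1) {H : Type*} [NormedAddCommGroup H] [InnerProductSpace ℂ H]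

/-- `X(f) f^(n+1) = f^(n+2) + [n+1]_q f^n` is the recurrence defining `qHermite`. Orthogonality of
the polynomials thus becomes orthogonality of the tensor powers. -/
theorem cfc_qHermite_vacuum {f : H} (hf : ‖f‖ = 1) : ∀ n,
    cfc (qHermite q n) (qGauss q f) (vacuum q H) = QFock.of q (ι ℂ f ^ n)
  | 0 => by
    have hX := isSelfAdjoint_qGauss q f
    change cfc (fun _ => (1 : ℝ)) (qGauss q f) (vacuum q H) = _
    rw [cfc_const_one ℝ (qGauss q f), pow_zero]
    rfl
  | 1 => by
    have hX := isSelfAdjoint_qGauss q f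
    change cfc (fun x : ℝ => x) (qGauss q f) (vacuum q H) = _
    rw [cfc_id' ℝ (qGauss q f), qGauss_vacuum, pow_one]
  | n + 2 => by
    have hX := isSelfAdjoint_qGauss q f
    have h1 := (continuous_qHermite q (n + 1)).continuousOn (s := spectrum ℝ (qGauss q f))
    have h2 := (continuous_qHermite q n).continuousOn (s := spectrum ℝ (qGauss q f))
    change cfc (fun x : ℝ => x * qHermite q (n + 1) x - qInt q (n + 1) * qHermite q n x)
      (qGauss q f) (vacuum q H) = _
    rw [cfc_sub (fun x : ℝ => x * qHermite q (n + 1) x) (fun x => qInt q (n + 1) * qHermite q n x)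
        (qGauss q f) (continuousOn_id.mul h1) (continuousOn_const.mul h2),
      cfc_mul (fun x : ℝ => x) (qHermite q (n + 1)) (qGauss q f) continuousOn_id h1,
      cfc_const_mul (qInt q (n + 1)) (qHermite q n) (qGauss q f) h2, cfc_id' ℝ (qGauss q f),
      sub_apply, mul_apply_eq_comp, smul_apply, cfc_qHermite_vacuum hf (n + 1),
      cfc_qHermite_vacuum hf n, qGauss_of, annihAlg_pow_self _ hf, QFock.of_add, QFock.of_smul,
      Complex.coe_smul, add_sub_cancel_left, ← pow_succ']

theorem integral_qHermite_mul {f : H} (hf : ‖f‖ = 1) (m n : ℕ) :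
    ∫ y, qHermite q m y * qHermite q n y ∂(vacuumDist q (qGauss q f))
      = if m = n then qFact q n else 0 := by
  rw [vacuumDist, integral_mul_distIn _ (continuous_qHermite q m) (continuous_qHermite q n),
    cfc_qHermite_vacuum q hf, cfc_qHermite_vacuum q hf, QFock.inner_of, qForm_pow_pow _ hf]
  split_ifs <;> simp

theorem norm_qGauss_le {f : H} (hf : ‖f‖ = 1) : ‖qGauss q f‖ ≤ 2 / √(1 - q) := by
  have hb := qBound_nonneg q f
  have h1 : ‖annih q f‖ ≤ qBound q f := by
    refine ContinuousLinearMap.opNorm_le_bound _ hb fun x => ?_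
    induction x using UniformSpace.Completion.induction_on with
    | hp => exact isClosed_le (by fun_prop) (by fun_prop)
    | ih ξ =>
      have h := norm_preAnnih_le q f ξ
      rw [annih, ContinuousLinearMap.completion_apply_coe, UniformSpace.Completion.norm_coe,
        UniformSpace.Completion.norm_coe]
      exact h
  have h2 : ‖creat q f‖ ≤ qBound q f := by
    rw [← adjoint_annih, LinearIsometryEquiv.norm_map]
    exact h1
  refine (norm_add_le _ _).trans ?_
  rw [qBound, hf] at h1 h2
  calc ‖annih q f‖ + ‖creat q f‖ ≤ 1 / √(1 - q) + 1 / √(1 - q) := add_le_add h1 h2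
    _ = 2 / √(1 - q) := by ring

theorem isProbabilityMeasure_qGauss {f : H} (hf : ‖f‖ = 1) :
    IsProbabilityMeasure (vacuumDist q (qGauss q f)) := by
  have h := integral_qHermite_mul q hf 0 0
  have : IsFiniteMeasure (vacuumDist q (qGauss q f)) := finite_distIn _ _
  simp only [qHermite, mul_one, integral_const, smul_eq_mul, if_pos, qFact] at h
  exact isProbabilityMeasure_iff_real.mpr h

theorem exists_nontrivial_law_preserving {f : H} (hf : ‖f‖ = 1) :
    ∃ γ : ℝ → ℝ, Continuous γ ∧
      (vacuumDist q (qGauss q f)).map γ = vacuumDist q (qGauss q f) ∧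
      ¬ (γ =ᵐ[vacuumDist q (qGauss q f)] fun x => x) ∧
      ¬ (γ =ᵐ[vacuumDist q (qGauss q f)] fun x => -x) := by
  have h0 := q.2.1
  have h1 := q.2.2
  have h1' : (0 : ℝ) < 1 - q := sub_pos.mpr h1
  have hi : ∀ g : ℝ → ℝ, Continuous g → Integrable g (vacuumDist q (qGauss q f)) :=
    fun g hg => integrable_distIn _ _ hg
  have ho := integral_qHermite_mul q hf
  have hp := isProbabilityMeasure_qGauss q hf
  have := noAtoms_of_orthogonal h0 h1 hi ho
  have hr : 0 < 2 / √(1 - (q : ℝ)) := div_pos two_pos (Real.sqrt_pos.mpr h1')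
  have hrr : (2 / √(1 - (q : ℝ))) ^ 2 = 4 / (1 - q) := by
    rw [div_pow, Real.sq_sqrt h1'.le]; norm_num
  have hn1 : ‖(1 : QFock q H →L[ℂ] QFock q H)‖ ≤ 1 := ContinuousLinearMap.norm_id_le
  refine exists_folding_map hr (distIn_compl_Icc _ _ fun x hx => ?_) fun x hx δ hδ => ?_
  · refine abs_le.mp ((spectrum.norm_le_norm_mul_of_mem hx).trans ?_)
    exact (mul_le_of_le_one_right (norm_nonneg _) hn1).trans (norm_qGauss_le q hf)
  · refine measure_Ioo_ne_zero_of_orthogonal h0 h1 hi ho ?_ hδ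
    rw [← hrr, sq_lt_sq, abs_of_pos hr]
    exact abs_lt.mpr hx

theorem integral_pow_four_vacuumDist {T : QFock q H →L[ℂ] QFock q H} (hT : IsSelfAdjoint T) :
    ∫ x, x ^ 4 ∂(vacuumDist q T) = (vacuumExp q (T ^ 4)).re := by
  rw [vacuumDist, integral_distIn_of_continuous _ _ (by fun_prop), cfc_pow_id T 4 hT]
  rfl

theorem norm_sq_of_ι {f : H} (hf : ‖f‖ = 1) : ‖QFock.of q (ι ℂ f)‖ ^ 2 = 1 := by
  rw [← inner_self_eq_norm_sq (𝕜 := ℂ), QFock.inner_of]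
  have := qForm_pow_pow q hf 1 1
  rw [pow_one] at this
  simp [this, qFact, qInt]

/-- The general formula at `γ = id`, where the crossing term is `q`: `(2 + q) + 4 + (2 + q) + 2q`.
-/
theorem vacuumExp_qGauss_add_qGauss_pow_four {f g : H} (hf : ‖f‖ = 1) (hg : ‖g‖ = 1)
    (hfg : inner ℂ f g = 0) :
    vacuumExp q ((qGauss q f + qGauss q g) ^ 4) = 8 + 4 * ((q : ℝ) : ℂ) := by
  have hX := isSelfAdjoint_qGauss q f
  have h := vacuumExp_cfc_add_qGauss_pow_four q hf hg hfg (γ := fun x => x) continuous_id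
  have e : inner ℂ (creat q g (QFock.of q (ι ℂ f))) (qGauss q f (QFock.of q (ι ℂ g)))
      = ((q : ℝ) : ℂ) := by
    have h1 : annihAlg q f (ι ℂ g) = 0 := by rw [annihAlg_ι, hfg, map_zero]
    have h2 := annihAlg_pow_mul q (inner_eq_zero_symm.mp hfg) 1 (ι ℂ g)
    have h3 := qForm_pow_pow q hf 1 1
    rw [annihAlg_ι, inner_self_eq_norm_sq_to_K, hg, pow_one, pow_one] at h2
    rw [pow_one] at h3
    rw [qGauss_of, h1, zero_add, creat_of, QFock.inner_of, qForm_ι_mul, h2, qForm_smul_right]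
    simp [h3, qFact, qInt]
  rw [cfc_id' ℝ (qGauss q f), qGauss_vacuum, e, norm_sq_qGauss_ι q hf, norm_sq_of_ι q hf] at h
  rw [h]
  simp
  ring

theorem re_vacuumExp_pow_four_lt {f g : H} (hf : ‖f‖ = 1) (hg : ‖g‖ = 1)
    (hfg : inner ℂ f g = 0) {γ : ℝ → ℝ} (hγ : Continuous γ)
    (hmap : (vacuumDist q (qGauss q f)).map γ = vacuumDist q (qGauss q f))
    (hne : ¬ (γ =ᵐ[vacuumDist q (qGauss q f)] fun x => x))
    (hne' : ¬ (γ =ᵐ[vacuumDist q (qGauss q f)] fun x => -x)) :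
    (vacuumExp q ((cfc γ (qGauss q f) + qGauss q g) ^ 4)).re < 8 + 4 * (q : ℝ) := by
  have hX := isSelfAdjoint_qGauss q f
  set μ := vacuumDist q (qGauss q f) with hμ
  have hi : ∀ k : ℝ → ℝ, Continuous k → Integrable k μ := fun k hk => integrable_distIn _ _ hk
  have hpush : ∀ k : ℝ → ℝ, Continuous k → ∫ x, k (γ x) ∂μ = ∫ x, k x ∂μ := fun k hk => by
    conv_rhs => rw [← hmap]
    exact (integral_map hγ.aemeasurable hk.aestronglyMeasurable).symm
  have hXid : cfc (fun x : ℝ => x) (qGauss q f) = qGauss q f := cfc_id' ℝ (qGauss q f)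
  have m2 : ∫ x, x * x ∂μ = 1 := by
    rw [hμ, vacuumDist, ← norm_sq_cfc_apply _ _ continuous_id', hXid, qGauss_vacuum,
      norm_sq_of_ι q hf]
  have m1 : ∫ x, x ∂μ = 0 := by
    have := integral_qHermite_mul q hf 0 1
    simpa [qHermite] using this
  have m2' : ∫ x, γ x * γ x ∂μ = 1 := (hpush (fun x => x * x) (by fun_prop)).trans m2
  have n2 : ‖cfc γ (qGauss q f) (vacuum q H)‖ ^ 2 = 1 := by
    rw [norm_sq_cfc_apply _ _ hγ]; exact m2'
  have n4 : ‖cfc γ (qGauss q f) (cfc γ (qGauss q f) (vacuum q H))‖ ^ 2 = 2 + (q : ℝ) := by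
    rw [← mul_apply_eq_comp, ← cfc_mul γ γ (qGauss q f) hγ.continuousOn hγ.continuousOn,
      norm_sq_cfc_apply _ _ (g := fun x => γ x * γ x) (hγ.mul hγ), ← norm_sq_qGauss_ι q hf,
      ← qGauss_vacuum]
    have e : qGauss q f (qGauss q f (vacuum q H))
        = cfc (fun x : ℝ => x * x) (qGauss q f) (vacuum q H) := by
      rw [cfc_mul (fun x : ℝ => x) (fun x => x) (qGauss q f) continuousOn_id continuousOn_id, hXid,
        mul_apply_eq_comp]
    rw [e, norm_sq_cfc_apply _ _ (by fun_prop)]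
    exact hpush (fun x => (x * x) * (x * x)) (by fun_prop)
  have c0 : inner ℂ (vacuum q H) (cfc γ (qGauss q f) (vacuum q H)) = 0 := by
    have e := inner_cfc_cfc (vacuum q H) (qGauss q f) (g := fun _ => 1) continuous_const hγ
    rw [cfc_const_one ℝ (qGauss q f)] at e
    refine e.trans ?_
    simp only [one_mul]
    rw [Complex.ofReal_eq_zero]
    exact (hpush (fun x => x) continuous_id).trans m1
  -- This is the correlation of `γ(X(f))` with `X(f)`, hence the coefficient `c_1` of `f`.
  set c := ∫ x, x * γ x ∂μ with hc
  have c1 : inner ℂ (QFock.of q (ι ℂ f)) (cfc γ (qGauss q f) (vacuum q H)) = (c : ℂ) := by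
    rw [← qGauss_vacuum]
    have e := inner_cfc_cfc (vacuum q H) (qGauss q f) (g := fun x => x) continuous_id' hγ
    rw [hXid] at e
    exact e
  -- The equality case of Cauchy–Schwarz, through `∫ (γ - s x)² dμ`; the signs `s = 1` and `s = -1`
  -- together give `|c| < 1`.
  have pos : ∀ s : ℝ, s ^ 2 = 1 → ¬ (γ =ᵐ[μ] fun x => s * x) → 0 < 2 - 2 * s * c := by
    intro s hs hns
    have e : ∫ x, (γ x - s * x) ^ 2 ∂μ = 2 - 2 * s * c := by
      have e1 : ∀ x, (γ x - s * x) ^ 2 = γ x * γ x + s ^ 2 * (x * x) + (-2 * s) * (x * γ x) :=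
        fun x => by ring
      simp_rw [e1]
      rw [integral_add (hi _ (by fun_prop)) (hi _ (by fun_prop)),
        integral_add (hi _ (by fun_prop)) (hi _ (by fun_prop)), integral_const_mul,
        integral_const_mul, m2, m2', hs]
      ring
    rw [← e]
    refine lt_of_le_of_ne (integral_nonneg fun x => sq_nonneg _) fun h => hns ?_
    have := (integral_eq_zero_iff_of_nonneg (fun x => sq_nonneg _)
      (hi _ ((hγ.sub (continuous_const.mul continuous_id)).pow 2))).mp h.symm
    filter_upwards [this] with x hx
    exact sub_eq_zero.mp (pow_eq_zero_iff two_ne_zero |>.mp hx)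
  have p1 := pos 1 (by norm_num) (by simpa using hne)
  have p2 := pos (-1) (by norm_num) (by simpa using hne')
  have hle := re_inner_creat_cfc_le q hf hg hfg hγ
  have h0 := q.2.1
  have h1 := q.2.2
  rw [c0, c1, n2, Complex.norm_real, Real.norm_eq_abs, sq_abs, norm_zero] at hle
  rw [vacuumExp_cfc_add_qGauss_pow_four q hf hg hfg hγ, Complex.ofReal_re, n2, n4]
  have hc1 : c ^ 2 < 1 := by nlinarith
  have hq : 0 < (q : ℝ) - (q : ℝ) ^ 2 := by nlinarith
  nlinarith [mul_pos hq (sub_pos.mpr hc1)]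

end GaussianLaw

end

theorem theorem1 {H : Type*} [NormedAddCommGroup H] [InnerProductSpace ℂ H] [CompleteSpace H]
    (q : Set.Ioo (0 : ℝ) 1) (f₀ f₁ : H) (h₀ : ‖f₀‖ = 1) (h₁ : ‖f₁‖ = 1)
    (h₀₁ : inner ℂ f₀ f₁ = 0) :
    (∃ γ : ℝ → ℝ, Continuous γ ∧
      vacuumDist q (cfc γ (qGauss q f₀)) = vacuumDist q (qGauss q f₀) ∧
      vacuumDist q (cfc γ (qGauss q f₀) + qGauss q f₁)
        ≠ vacuumDist q (qGauss q f₀ + qGauss q f₁) ∧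
      vacuumExp q ((qGauss q f₀ + qGauss q f₁) ^ 4) = 8 + 4 * ((q : ℝ) : ℂ) ∧
      (vacuumExp q ((cfc γ (qGauss q f₀) + qGauss q f₁) ^ 4)).re < 8 + 4 * (q : ℝ)) ∧
    ¬ ∃ conv : MeasureTheory.Measure ℝ → MeasureTheory.Measure ℝ → MeasureTheory.Measure ℝ,
      ∀ φ ψ : ℝ → ℝ, Continuous φ → Continuous ψ →
        vacuumDist q (cfc φ (qGauss q f₀) + cfc ψ (qGauss q f₁))
          = conv (vacuumDist q (cfc φ (qGauss q f₀))) (vacuumDist q (cfc ψ (qGauss q f₁))) := by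
  obtain ⟨γ, hγ, hmap, hne, hne'⟩ := exists_nontrivial_law_preserving q h₀
  have hlaw : vacuumDist q (cfc γ (qGauss q f₀)) = vacuumDist q (qGauss q f₀) :=
    (distIn_cfc _ (isSelfAdjoint_qGauss q f₀) hγ).trans hmap
  have heq := vacuumExp_qGauss_add_qGauss_pow_four q h₀ h₁ h₀₁
  have hlt := re_vacuumExp_pow_four_lt q h₀ h₁ h₀₁ hγ hmap hne hne'
  have hdist : vacuumDist q (cfc γ (qGauss q f₀) + qGauss q f₁)
      ≠ vacuumDist q (qGauss q f₀ + qGauss q f₁) := by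
    intro h
    have h4 := integral_pow_four_vacuumDist q
      ((isSelfAdjoint_qGauss q f₀).add (isSelfAdjoint_qGauss q f₁))
    rw [← h, integral_pow_four_vacuumDist q
      ((cfc_predicate γ (qGauss q f₀)).add (isSelfAdjoint_qGauss q f₁)), heq] at h4
    refine hlt.ne (h4.trans ?_)
    simp
  refine ⟨⟨γ, hγ, hlaw, hdist, heq, hlt⟩, ?_⟩
  rintro ⟨conv, hconv⟩
  have hX₀ : cfc (fun x : ℝ => x) (qGauss q f₀) = qGauss q f₀ :=
    cfc_id' ℝ (qGauss q f₀) (isSelfAdjoint_qGauss q f₀)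
  have hX₁ : cfc (fun x : ℝ => x) (qGauss q f₁) = qGauss q f₁ :=
    cfc_id' ℝ (qGauss q f₁) (isSelfAdjoint_qGauss q f₁)
  -- The two applications feed `conv` the same pair of laws, yet the left sides differ by `hdist`.
  have e₁ := hconv γ (fun x => x) hγ continuous_id
  have e₂ := hconv (fun x => x) (fun x => x) continuous_id continuous_id
  rw [hX₁, hlaw] at e₁
  rw [hX₀, hX₁] at e₂
  exact hdist (e₁.trans e₂.symm)
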